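/- Let $\mathcal H=L^2(\mathbb R^2)$ and let $U_t=e^{-itH}$, $t\in\mathbb R$, be the strongly continuous unitary group on $\mathcal H$ generated by the Hamiltonian $$H=-\tfrac12\frac{\partial^2}{\partial x^2}-\tfrac12\frac{\partial^2}{\partial y^2}+\tfrac12(x-y)^2$$ of two coupled oscillators. For $\alpha\in\mathbb C$ let $\xi_\alpha(u)=\pi^{-1/4}\exp\left(-\frac{|\alpha|^2}{2}\right)\exp\left(-\frac{u^2-2\sqrt2\,\alpha u+\alpha^2}{2}\right)$ be the coherent state in $L^2(\mathbb R)$, and for $\alpha,\beta\in\mathbb C$ put $$\psi_{\alpha\beta}(x,y)=2^{1/4}\,\xi_\alpha\left(\frac{x+y}{\sqrt[4]{2}}\right)\xi_\beta\left(\frac{x-y}{\sqrt[4]{2}}\right),\qquad Q_\beta=\frac1\pi\int_{\mathbb C}|\psi_{\alpha\beta}\rangle\langle\psi_{\alpha\beta}|\,d^2\alpha$$ (the integral is a weak one). Fix $\varphi\in\mathbb R$ and let $$\mathcal V=\overline{\operatorname{span}}\{U_tQ_{re^{i\varphi}}U_t^*:\ t\in\mathbb R,\ r\ge 0\},$$ where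 the closure is taken in the weak operator topology (equivalently, the strong one). Then $\mathcal V$ is a non-commutative graph, that is, a linear space of bounded operators that contains the identity and is closed under adjoints. A quantum anticlique for $\mathcal V$ is an orthogonal projection $P$ on $\mathcal H$ of rank at least $2$ with $\dim P\mathcal VP=1$; it is maximal if there is no quantum anticlique $\hat P$ for $\mathcal V$ with $P<\hat P$, that is, $\hat P\ne P$ and $\hat P-P$ is positive semidefinite. Theorem 2. Let $g_0\in L^2(\mathbb R)$ be a unit vector, let $\{\varphi_k\}_{k\ge1}$ be an orthonormal basis of $L^2(\mathbb R)$, and set $$\eta_k(x,y)=\varphi_k\left(\frac{x+y}{\sqrt2}\right)g_0\left(\frac{x-y}{\sqrt2}\right),\qquad k=1,2,\dots$$ Then the $\eta_k$ are orthonormal in $L^2(\mathbb R^2)$, and the infinite-rank projection $P=\sum_{k=1}^\infty|\eta_k\rangle\langle\eta_k|$ (a strongly convergent sum) is a maximal quantum anticlique for $\mathcal V$. -/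

import Mathlib

open MeasureTheory
open scoped SchwartzMap LineDeriv InnerProductSpace

noncomputable section

namespace OscillatorGraph

/-! ### Non-commutative graphs and quantum anticliques -/

section Abstract

variable {H : Type*} [NormedAddCommGroup H] [InnerProductSpace ℂ H] [CompleteSpace H]

/-- A non-commutative graph: a linear space of bounded operators that contains the identity and
is closed under taking adjoints. -/
structure IsNoncommutativeGraph (V : Submodule ℂ (H →L[ℂ] H)) : Prop where
  star_mem : ∀ A ∈ V, star A ∈ V
  one_mem : (1 : H →L[ℂ] H) ∈ V

/-- The space `P V P = {P A P : A ∈ V}`. -/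
def compression (P : H →L[ℂ] H) (V : Submodule ℂ (H →L[ℂ] H)) : Submodule ℂ (H →L[ℂ] H) :=
  V.map (LinearMap.mulLeftRight ℂ (P, P))

/-- A quantum anticlique for `V`: an orthogonal projection of rank at least two such that
`P V P` is one-dimensional. -/
structure IsQuantumAnticlique (V : Submodule ℂ (H →L[ℂ] H)) (P : H →L[ℂ] H) : Prop where
  isStarProjection : IsStarProjection P
  two_le_rank : 2 ≤ LinearMap.rank (P : H →ₗ[ℂ] H)
  finrank_compression : Module.finrank ℂ (compression P V) = 1

/-- A quantum anticlique that no quantum anticlique strictly dominates. The order on operators is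
the Loewner order: `A ≤ B` if and only if `B - A` is positive semidefinite. -/
structure IsMaximalQuantumAnticlique (V : Submodule ℂ (H →L[ℂ] H)) (P : H →L[ℂ] H) : Prop where
  isQuantumAnticlique : IsQuantumAnticlique V P
  maximal : ¬ ∃ P' : H →L[ℂ] H, IsQuantumAnticlique V P' ∧ P < P'

/-- The closure of the linear span of a set of bounded operators in the weak operator topology
(a linear space of operators has the same closure in the strong operator topology). -/
def closedSpan (S : Set (H →L[ℂ] H)) : Submodule ℂ (H →L[ℂ] H) :=
  (((Submodule.span ℂ S).comap
    (ContinuousLinearMapWOT.linearEquiv (σ := RingHom.id ℂ) (E := H) (F := H)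
      ℂ).toLinearMap).topologicalClosure).comap
    (ContinuousLinearMapWOT.linearEquiv (σ := RingHom.id ℂ) (E := H) (F := H) ℂ).symm.toLinearMap

end Abstract

/-! ### Functions of `x + y` and `x - y` -/

/-- The Hilbert space of a single mode. -/
abbrev L2R : Type := Lp ℂ 2 (volume : Measure ℝ)

/-- The Hilbert space of two modes. -/
abbrev L2R2 : Type := Lp ℂ 2 (volume : Measure (ℝ × ℝ))

/-- The function `(x, y) ↦ f ((x + y) / c) * g ((x - y) / c)`. -/
def sumDiff (c : ℝ) (f g : ℝ → ℂ) (p : ℝ × ℝ) : ℂ :=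
  f ((p.1 + p.2) / c) * g ((p.1 - p.2) / c)

/-- The linear change of variables `(x, y) ↦ ((x + y) / c, (x - y) / c)`. -/
def sumDiffEquiv (c : ℝ) (hc : c ≠ 0) : (ℝ × ℝ) ≃L[ℝ] ℝ × ℝ :=
  LinearEquiv.toContinuousLinearEquiv
    { toFun := fun p => ((p.1 + p.2) / c, (p.1 - p.2) / c)
      map_add' := fun p q => by ext <;> simp <;> ring
      map_smul' := fun a p => by ext <;> simp <;> ring
      invFun := fun p => (c * (p.1 + p.2) / 2, c * (p.1 - p.2) / 2)
      left_inv := fun p => by ext <;> simp <;> field_simp <;> ring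
      right_inv := fun p => by ext <;> simp <;> field_simp <;> ring }

theorem memLp_sumDiff {c : ℝ} (hc : c ≠ 0) {f g : ℝ → ℂ} (hf : MemLp f 2 (volume : Measure ℝ))
    (hg : MemLp g 2 (volume : Measure ℝ)) :
    MemLp (sumDiff c f g) 2 (volume : Measure (ℝ × ℝ)) := by
  have hprod : MemLp (fun p : ℝ × ℝ => f p.1 * g p.2) 2 (volume : Measure (ℝ × ℝ)) := by
    have hm : AEStronglyMeasurable (fun p : ℝ × ℝ => f p.1 * g p.2)
        ((volume : Measure ℝ).prod (volume : Measure ℝ)) :=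
      hf.1.comp_fst.mul hg.1.comp_snd
    rw [Measure.volume_eq_prod]
    rw [memLp_two_iff_integrable_sq_norm hm]
    have h1 := (memLp_two_iff_integrable_sq_norm hf.1).1 hf
    have h2 := (memLp_two_iff_integrable_sq_norm hg.1).1 hg
    simpa [mul_pow] using h1.mul_prod h2
  have hdet : LinearMap.det ((sumDiffEquiv c hc).toLinearEquiv : (ℝ × ℝ) →ₗ[ℝ] ℝ × ℝ) ≠ 0 :=
    (LinearEquiv.isUnit_det' _).ne_zero
  have hmap := Measure.map_linearMap_addHaar_eq_smul_addHaar
    (volume : Measure (ℝ × ℝ)) hdet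
  have h3 : MemLp (fun p : ℝ × ℝ => f p.1 * g p.2) 2
      (Measure.map (sumDiffEquiv c hc).toHomeomorph.toMeasurableEquiv
        (volume : Measure (ℝ × ℝ))) := by
    have h4 := hprod.smul_measure (c := ENNReal.ofReal
      |(LinearMap.det ((sumDiffEquiv c hc).toLinearEquiv : (ℝ × ℝ) →ₗ[ℝ] ℝ × ℝ))⁻¹|) (by simp)
    rw [← hmap] at h4
    exact h4
  exact (MeasurableEquiv.memLp_map_measure_iff _).1 h3

/-- The element of `L²(ℝ²)` given by `(x, y) ↦ f ((x + y) / √2) * g ((x - y) / √2)`. -/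
def modeProduct (f g : L2R) : L2R2 :=
  (memLp_sumDiff (c := √2) (by positivity) (Lp.memLp f) (Lp.memLp g)).toLp _

/-! ### Coherent states -/

/-- The coherent state `ξ_α` of a single mode. -/
def coherent (α : ℂ) (u : ℝ) : ℂ :=
  (Real.pi ^ (-(1 / 4) : ℝ) : ℝ) * Complex.exp (-(‖α‖ : ℂ) ^ 2 / 2) *
    Complex.exp (-((u : ℂ) ^ 2 - 2 * √2 * α * u + α ^ 2) / 2)

theorem memLp_coherent (α : ℂ) : MemLp (coherent α) 2 (volume : Measure ℝ) := by
  have hc : Continuous (coherent α) := by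
    unfold coherent
    fun_prop
  rw [memLp_two_iff_integrable_sq_norm hc.aestronglyMeasurable]
  have h := (integrable_exp_neg_mul_sq (b := 1) one_pos).comp_sub_right (√2 * α.re)
  refine (h.const_mul ((Real.pi ^ (-(1 / 4) : ℝ)) ^ 2)).congr (Filter.Eventually.of_forall ?_)
  intro u
  have hs : (√2 : ℝ) ^ 2 = 2 := Real.sq_sqrt (by norm_num)
  have hn : ‖α‖ ^ 2 = α.re ^ 2 + α.im ^ 2 := by
    rw [Complex.sq_norm, Complex.normSq_apply]; ring
  have e1 : (-(‖α‖ : ℂ) ^ 2 / 2).re = -(α.re ^ 2 + α.im ^ 2) / 2 := by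
    rw [← hn]
    have : (-(‖α‖ : ℂ) ^ 2 / 2) = ((-‖α‖ ^ 2 / 2 : ℝ) : ℂ) := by push_cast; ring
    rw [this, Complex.ofReal_re]
  have e2 : (-((u : ℂ) ^ 2 - 2 * √2 * α * u + α ^ 2) / 2).re
      = -(u ^ 2 - 2 * √2 * α.re * u + (α.re ^ 2 - α.im ^ 2)) / 2 := by
    have : (-((u : ℂ) ^ 2 - 2 * √2 * α * u + α ^ 2) / 2)
        = ((-(1 / 2) : ℝ) : ℂ) * (((u ^ 2 : ℝ) : ℂ) - ((2 * √2 * u : ℝ) : ℂ) * α + α ^ 2) := by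
      push_cast; ring
    rw [this, Complex.re_ofReal_mul]
    simp only [Complex.add_re, Complex.sub_re, Complex.re_ofReal_mul, Complex.ofReal_re,
      pow_two α, Complex.mul_re α α]
    ring
  simp only [coherent, norm_mul, Complex.norm_exp, e1, e2, mul_pow, Complex.norm_real,
    Real.norm_eq_abs, sq_abs]
  rw [mul_assoc, ← Real.exp_nat_mul, ← Real.exp_nat_mul, ← Real.exp_add]
  congr 2
  push_cast
  linear_combination (-α.re ^ 2) * hs

/-- The two-mode coherent state
`ψ_{αβ}(x, y) = 2^{1/4} ξ_α((x + y) / 2^{1/4}) ξ_β((x - y) / 2^{1/4})`, a unit vector of `L²(ℝ²)`. -/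
def twoModeCoherent (α β : ℂ) : L2R2 :=
  ((2 : ℝ) ^ (1 / 4 : ℝ)) • (memLp_sumDiff (c := (2 : ℝ) ^ (1 / 4 : ℝ)) (by positivity)
    (memLp_coherent α) (memLp_coherent β)).toLp _

/-- `Q` is the operator `Q_β = π⁻¹ ∫_ℂ |ψ_{αβ}⟩⟨ψ_{αβ}| d²α`; the integral is a weak one, that is, it
is taken in matrix elements. There is at most one such `Q`. -/
def IsCoherentIntegral (β : ℂ) (Q : L2R2 →L[ℂ] L2R2) : Prop :=
  ∀ f g : L2R2,
    Integrable (fun α : ℂ => ⟪f, twoModeCoherent α β⟫_ℂ * ⟪twoModeCoherent α β, g⟫_ℂ) ∧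
    ⟪f, Q g⟫_ℂ =
      (Real.pi : ℂ)⁻¹ * ∫ α : ℂ, ⟪f, twoModeCoherent α β⟫_ℂ * ⟪twoModeCoherent α β, g⟫_ℂ

/-! ### The dynamics -/

/-- The Hamiltonian `H = -½ ∂²/∂x² - ½ ∂²/∂y² + ½ (y - x)²` on the Schwartz space. -/
def hamiltonian (ψ : 𝓢(ℝ × ℝ, ℂ)) : 𝓢(ℝ × ℝ, ℂ) :=
  -((1 / 2 : ℝ) • ∂_{((1, 0) : ℝ × ℝ)} (∂_{((1, 0) : ℝ × ℝ)} ψ))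
    - (1 / 2 : ℝ) • ∂_{((0, 1) : ℝ × ℝ)} (∂_{((0, 1) : ℝ × ℝ)} ψ)
    + SchwartzMap.smulLeftCLM ℂ (fun p : ℝ × ℝ => (p.2 - p.1) ^ 2 / 2) ψ

/-- The multiplication operator in `hamiltonian` is the intended one. -/
theorem hamiltonian_apply (ψ : 𝓢(ℝ × ℝ, ℂ)) (p : ℝ × ℝ) :
    hamiltonian ψ p =
      -((1 / 2 : ℝ) • (∂_{((1, 0) : ℝ × ℝ)} (∂_{((1, 0) : ℝ × ℝ)} ψ)) p)
        - (1 / 2 : ℝ) • (∂_{((0, 1) : ℝ × ℝ)} (∂_{((0, 1) : ℝ × ℝ)} ψ)) p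
        + ((p.2 - p.1) ^ 2 / 2 : ℝ) • ψ p := by
  have h : (fun p : ℝ × ℝ => (p.2 - p.1) ^ 2 / 2).HasTemperateGrowth := by
    have h1 : (fun p : ℝ × ℝ => p.1).HasTemperateGrowth :=
      (ContinuousLinearMap.fst ℝ ℝ ℝ).hasTemperateGrowth
    have h2 : (fun p : ℝ × ℝ => p.2).HasTemperateGrowth :=
      (ContinuousLinearMap.snd ℝ ℝ ℝ).hasTemperateGrowth
    simp only [div_eq_mul_inv, pow_two]
    exact ((h2.sub h1).mul (h2.sub h1)).mul (Function.HasTemperateGrowth.const _)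
  simp [hamiltonian, SchwartzMap.smulLeftCLM_apply_apply h]

/-- `U` is the strongly continuous unitary group `U_t = e^{-itH}`, whose orbits solve the
Schrödinger equation `i ∂ψ/∂t = H ψ`. Since `H` is essentially self-adjoint on the Schwartz space,
the conditions below are fulfilled by exactly one `U`. -/
structure IsSchrodingerGroup (U : ℝ → unitary (L2R2 →L[ℂ] L2R2)) : Prop where
  map_add : ∀ s t : ℝ, U (s + t) = U s * U t
  continuous_apply : ∀ f : L2R2, Continuous fun t : ℝ => (U t : L2R2 →L[ℂ] L2R2) f
  hasDerivAt : ∀ ψ : 𝓢(ℝ × ℝ, ℂ),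
    HasDerivAt (fun t : ℝ => (U t : L2R2 →L[ℂ] L2R2) (ψ.toLp 2 volume))
      (-Complex.I • (hamiltonian ψ).toLp 2 volume) 0

/-- The closed linear span of the operators `U_t Q_β U_t^*` with `t ∈ ℝ` and `β = r e^{iφ}`,
`r ≥ 0`. -/
def oscillatorGraph (U : ℝ → unitary (L2R2 →L[ℂ] L2R2)) (φ : ℝ) :
    Submodule ℂ (L2R2 →L[ℂ] L2R2) :=
  closedSpan {A | ∃ (t r : ℝ) (Q : L2R2 →L[ℂ] L2R2), 0 ≤ r ∧
    IsCoherentIntegral (r * Complex.exp (Complex.I * φ)) Q ∧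
    A = (U t : L2R2 →L[ℂ] L2R2) * Q * star (U t : L2R2 →L[ℂ] L2R2)}

end OscillatorGraph

end

/-!
In the coordinates `u = (x + y) / √2`, `v = (x - y) / √2` the Hamiltonian splits as
`-½ ∂²/∂u² + (-½ ∂²/∂v² + v²)`, a free particle and an oscillator of frequency `√2`, and `L²(ℝ²)` is
the Hilbert tensor product of the two modes; `mode g f` is the vector with factor `f` in `u` and `g`
in `v` (`isHilbertTensor_mode`).

The state `ψ_{αβ}` is the product of a coherent state `ξ_α` in `u` and a coherent state `ξ_β` in `v`
(coherent states are tacitly dilated by `2^{1/4}`, the width of the oscillator), so the resolution of the identity `π⁻¹ ∫ |ξ_α⟩⟨ξ_α| d²α = 1` shows that `Q_β` exists and equals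
`1 ⊗ |ξ_β⟩⟨ξ_β|` (`isCoherentIntegral_iff`). The oscillator carries `ξ_β` to a phase times
`ξ_{e^{-i√2t} β}`, whatever the free particle does, so `U_t Q_β U_t^*` is `1 ⊗ |ξ_β'⟩⟨ξ_β'|` with
`β' = e^{-i√2t} β` (`schrodinger_conj_ampRankOne`). This is read off from explicit Gaussian solutions
of the Schrödinger equation, which determine the unitary group. Letting `t` and `r` vary, the
generators of the graph are all the operators `1 ⊗ |ξ_β⟩⟨ξ_β|` with `β ∈ ℂ` (`generators_eq`).

The unnormalized coherent states form an entire family with values in `L²(ℝ)` that is total by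
injectivity of the Fourier transform. By the identity theorem in two variables, a closed space that
contains the diagonal `|ξ_β⟩⟨ξ_β|` contains every `|g⟩⟨h|` (`ampRankOne_mem_of_entire`). So the
graph contains all `1 ⊗ |g⟩⟨g|`, hence also the identity, as a strong limit.

For `P = 1 ⊗ |g₀⟩⟨g₀|` every element `A` of the graph satisfies `P A P ∈ ℂ P`, as this holds for the
generators and is a weak-operator closed condition. If `P' ≥ P` is another anticlique, then `P`
itself lies in the graph, so `P = P' P P'` is a multiple of `P'`, which forces `P = P'`
(`isMaximalQuantumAnticlique_ampRankOne`).
-/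

noncomputable section

namespace OscillatorGraph

open Filter Topology ContinuousLinearMap

/-! ### Weak-operator closed spans -/

section ClosedSpan

variable {H : Type*} [NormedAddCommGroup H] [InnerProductSpace ℂ H]

theorem mem_closedSpan_iff {S : Set (H →L[ℂ] H)} {A : H →L[ℂ] H} :
    A ∈ closedSpan S ↔ ContinuousLinearMapWOT.ofCLM A ∈
      closure {B : H →WOT[ℂ] H | B.toCLM ∈ Submodule.span ℂ S} :=
  Iff.rfl

theorem subset_closedSpan (S : Set (H →L[ℂ] H)) : S ⊆ closedSpan S := fun _ hA =>
  mem_closedSpan_iff.2 (subset_closure (Submodule.subset_span hA))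

/-- A closed span lies in every subspace that contains the generators and is the preimage of a
weak-operator closed set. -/
theorem closedSpan_le {S : Set (H →L[ℂ] H)} (W : Submodule ℂ (H →L[ℂ] H)) (hS : S ⊆ W)
    (hW : IsClosed {B : H →WOT[ℂ] H | B.toCLM ∈ W}) : closedSpan S ≤ W := by
  intro A hA
  have h := closure_minimal (s := {B : H →WOT[ℂ] H | B.toCLM ∈ Submodule.span ℂ S})
    (fun B hB => (Submodule.span_le.2 hS) hB) hW (mem_closedSpan_iff.1 hA)
  exact h

theorem isClosed_toCLM_closedSpan (S : Set (H →L[ℂ] H)) :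
    IsClosed {B : H →WOT[ℂ] H | B.toCLM ∈ closedSpan S} := by
  have : {B : H →WOT[ℂ] H | B.toCLM ∈ closedSpan S} =
      closure {B : H →WOT[ℂ] H | B.toCLM ∈ Submodule.span ℂ S} := by
    ext B; exact mem_closedSpan_iff
  rw [this]
  exact isClosed_closure

theorem isClosed_closedSpan (S : Set (H →L[ℂ] H)) :
    IsClosed (closedSpan S : Set (H →L[ℂ] H)) :=
  (isClosed_toCLM_closedSpan S).preimage ContinuousLinearMapWOT.continuous_ofCLM

/-- A closed span is closed under limits of sequences in the strong operator topology. -/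
theorem mem_closedSpan_of_tendsto [CompleteSpace H] {S : Set (H →L[ℂ] H)}
    {A : ℕ → H →L[ℂ] H} {B : H →L[ℂ] H}
    (hA : ∀ n, A n ∈ closedSpan S) (h : ∀ x, Tendsto (fun n => A n x) atTop (𝓝 (B x))) :
    B ∈ closedSpan S := by
  have ht : Tendsto (fun n => ContinuousLinearMapWOT.ofCLM (A n)) atTop
      (𝓝 (ContinuousLinearMapWOT.ofCLM B)) := by
    rw [ContinuousLinearMapWOT.tendsto_iff_forall_inner_apply_tendsto]
    intro x y
    exact tendsto_const_nhds.inner (h x)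
  exact (isClosed_toCLM_closedSpan S).mem_of_tendsto ht (Eventually.of_forall hA)

theorem star_mem_closedSpan [CompleteSpace H] {S : Set (H →L[ℂ] H)} (hS : ∀ A ∈ S, star A ∈ S)
    {A : H →L[ℂ] H} (hA : A ∈ closedSpan S) : star A ∈ closedSpan S := by
  have hspan : ∀ B ∈ Submodule.span ℂ S, star B ∈ Submodule.span ℂ S := by
    intro B hB
    induction hB using Submodule.span_induction with
    | mem x hx => exact Submodule.subset_span (hS x hx)
    | zero => simp
    | add x y _ _ hx hy => rw [star_add]; exact add_mem hx hy
    | smul c x _ hx => rw [star_smul]; exact Submodule.smul_mem _ _ hx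
  rw [mem_closedSpan_iff] at hA ⊢
  exact map_mem_closure (f := (star : (H →WOT[ℂ] H) → (H →WOT[ℂ] H))) continuous_star hA
    (fun B hB => hspan _ hB)

end ClosedSpan

/-! ### The identity theorem modulo a closed subspace -/

/-- An entire function with values in a Banach space that maps the real line into a closed subspace
takes all its values in that subspace. -/
theorem mem_of_forall_real_mem {B : Type*} [NormedAddCommGroup B] [NormedSpace ℂ B]
    [CompleteSpace B] (W : Submodule ℂ B) (hW : IsClosed (W : Set B)) {f : ℂ → B}
    (hf : Differentiable ℂ f) (h : ∀ x : ℝ, f x ∈ W) (z : ℂ) : f z ∈ W := by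
  have : IsClosed (W : Set B) := hW
  have hq : Differentiable ℂ fun z => W.mkQL (f z) := W.mkQL.differentiable.comp hf
  have han : AnalyticOnNhd ℂ (fun z => W.mkQL (f z)) Set.univ :=
    hq.differentiableOn.analyticOnNhd isOpen_univ
  have hz : ∃ᶠ z in 𝓝[≠] (0 : ℂ), W.mkQL (f z) = 0 := by
    have ht : Tendsto (fun x : ℝ => (x : ℂ)) (𝓝[≠] 0) (𝓝[≠] 0) := by
      refine tendsto_nhdsWithin_iff.2 ⟨?_, ?_⟩
      · exact (Complex.continuous_ofReal.tendsto' 0 0 (by simp)).mono_left nhdsWithin_le_nhds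
      · filter_upwards [self_mem_nhdsWithin] with x hx
        simpa using hx
    refine ht.frequently (Eventually.frequently (Eventually.of_forall fun x => ?_))
    exact (Submodule.Quotient.mk_eq_zero W).2 (h x)
  have h0 := han.eq_of_frequently_eq (g := fun _ => 0) analyticOnNhd_const hz
  exact (Submodule.Quotient.mk_eq_zero W).1 (congrFun h0 z)

/-! ### Amplified rank-one operators -/

section Tensor

variable {E F K : Type*} [NormedAddCommGroup E] [InnerProductSpace ℂ E]
  [NormedAddCommGroup F] [InnerProductSpace ℂ F]
  [NormedAddCommGroup K] [InnerProductSpace ℂ K]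

/-- A bounded bilinear map `M : E × F → K` of Hilbert spaces that presents `K` as the Hilbert space
tensor product of `E` and `F`: `M g f` plays the role of `f ⊗ g`. -/
structure IsHilbertTensor (M : E →L[ℂ] F →L[ℂ] K) : Prop where
  inner_apply : ∀ g g' f f', ⟪M g f, M g' f'⟫_ℂ = ⟪g, g'⟫_ℂ * ⟪f, f'⟫_ℂ
  dense : ∀ x : K, (∀ g f, ⟪M g f, x⟫_ℂ = 0) → x = 0

variable [CompleteSpace F] [CompleteSpace K]

/-- The operator `1 ⊗ |g⟩⟨h|` on the tensor product presented by `M`. -/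
def ampRankOne (M : E →L[ℂ] F →L[ℂ] K) (g h : E) : K →L[ℂ] K :=
  M g ∘L adjoint (M h)

theorem ampRankOne_apply (M : E →L[ℂ] F →L[ℂ] K) (g h : E) (x : K) :
    ampRankOne M g h x = M g (adjoint (M h) x) := rfl

theorem star_ampRankOne (M : E →L[ℂ] F →L[ℂ] K) (g h : E) :
    star (ampRankOne M g h) = ampRankOne M h g := by
  rw [star_eq_adjoint, ampRankOne, adjoint_comp, adjoint_adjoint, ampRankOne]

theorem ampRankOne_smul_left (M : E →L[ℂ] F →L[ℂ] K) (c : ℂ) (g h : E) :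
    ampRankOne M (c • g) h = c • ampRankOne M g h := by
  ext x; simp [ampRankOne_apply]

/-- `g ↦ 1 ⊗ |g⟩⟨h|` as a bounded linear map. -/
def ampRankOneCLM (M : E →L[ℂ] F →L[ℂ] K) (h : E) : E →L[ℂ] (K →L[ℂ] K) :=
  (ContinuousLinearMap.precomp K (adjoint (M h))) ∘L M

theorem ampRankOneCLM_apply (M : E →L[ℂ] F →L[ℂ] K) (g h : E) :
    ampRankOneCLM M h g = ampRankOne M g h := rfl

variable {M : E →L[ℂ] F →L[ℂ] K}

namespace IsHilbertTensor

theorem adjoint_apply_apply (hM : IsHilbertTensor M) (g h : E) (f : F) :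
    adjoint (M h) (M g f) = ⟪h, g⟫_ℂ • f := by
  refine ext_inner_left ℂ fun f' => ?_
  rw [adjoint_inner_right, hM.inner_apply, inner_smul_right]

theorem ampRankOne_mul (hM : IsHilbertTensor M) (g h g' h' : E) :
    ampRankOne M g h * ampRankOne M g' h' = ⟪h, g'⟫_ℂ • ampRankOne M g h' := by
  ext x
  simp [ampRankOne_apply, hM.adjoint_apply_apply]

theorem isStarProjection_ampRankOne (hM : IsHilbertTensor M) {g : E} (hg : ‖g‖ = 1) :
    IsStarProjection (ampRankOne M g g) where
  isIdempotentElem := by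
    rw [IsIdempotentElem, hM.ampRankOne_mul, inner_self_eq_norm_sq_to_K, hg]
    simp
  isSelfAdjoint := star_ampRankOne M g g

/-- `1 ⊗ |g⟩⟨g|` is the orthogonal projection onto the vectors of the form `f ⊗ g`. -/
theorem range_ampRankOne (hM : IsHilbertTensor M) {g : E} (hg : ‖g‖ = 1) :
    (ampRankOne M g g).range = (M g).range := by
  apply le_antisymm
  · rintro _ ⟨x, rfl⟩
    exact ⟨adjoint (M g) x, rfl⟩
  · rintro _ ⟨f, rfl⟩
    refine ⟨M g f, ?_⟩
    change M g (adjoint (M g) (M g f)) = M g f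
    rw [hM.adjoint_apply_apply, inner_self_eq_norm_sq_to_K, hg]
    simp

theorem sum_ampRankOne_apply (hM : IsHilbertTensor M) (ι : Type*) (s : Finset ι) (v : ι → E)
    (g : E) (f : F) :
    (∑ k ∈ s, ampRankOne M (v k) (v k)) (M g f) = M (∑ k ∈ s, ⟪v k, g⟫_ℂ • v k) f := by
  simp [ampRankOne_apply, hM.adjoint_apply_apply]

/-- The projections `1 ⊗ ∑_{k < n} |v k⟩⟨v k|` tend strongly to the identity if `v` is a Hilbert
basis. -/
theorem tendsto_sum_ampRankOne (hM : IsHilbertTensor M) (v : HilbertBasis ℕ ℂ E) (x : K) :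
    Tendsto (fun n => (∑ k ∈ Finset.range n, ampRankOne M (v k) (v k)) x) atTop (𝓝 x) := by
  set A : ℕ → K →L[ℂ] K := fun n => ∑ k ∈ Finset.range n, ampRankOne M (v k) (v k) with hA
  have hproj : ∀ n, IsStarProjection (A n) := by
    intro n
    refine ⟨?_, ?_⟩
    · rw [IsIdempotentElem, hA]
      simp only [Finset.sum_mul, Finset.mul_sum, hM.ampRankOne_mul]
      refine Finset.sum_congr rfl fun k hk => ?_
      simp only [orthonormal_iff_ite.1 v.orthonormal, ite_smul, one_smul, zero_smul]
      simp only [Finset.sum_ite_eq', hk, if_true]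
    · rw [isSelfAdjoint_iff, hA]
      simp only [star_sum, star_ampRankOne]
  have hnorm : ∀ n, ‖A n‖ ≤ 1 := fun n => IsStarProjection.norm_le _ (hproj n)
  -- Strong convergence holds on a closed subspace, and that subspace contains all `M g f`.
  let W : Submodule ℂ K :=
    { carrier := {x | Tendsto (fun n => A n x) atTop (𝓝 x)}
      add_mem' := fun {x y} hx hy => by simpa using Tendsto.add hx hy
      zero_mem' := by simp
      smul_mem' := fun c x hx => by simpa using Tendsto.const_smul hx c }
  have hWc : IsClosed (W : Set K) := by
    refine isClosed_of_closure_subset fun y hy => ?_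
    change Tendsto (fun n => A n y) atTop (𝓝 y)
    rw [Metric.tendsto_atTop]
    intro ε hε
    obtain ⟨z, hz, hyz⟩ := Metric.mem_closure_iff.1 hy (ε / 3) (by positivity)
    obtain ⟨N, hN⟩ := Metric.tendsto_atTop.1 hz (ε / 3) (by positivity)
    refine ⟨N, fun n hn => ?_⟩
    have h1 : dist (A n y) (A n z) ≤ dist y z := by
      rw [dist_eq_norm, dist_eq_norm, ← map_sub]
      exact (A n).le_of_opNorm_le (hnorm n) _ |>.trans (by simp)
    calc dist (A n y) y ≤ dist (A n y) (A n z) + dist (A n z) z + dist z y := dist_triangle4 _ _ _ _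
      _ < ε / 3 + ε / 3 + ε / 3 := by
        have := hN n hn
        rw [dist_comm z y]
        gcongr
        exact h1.trans_lt hyz
      _ = ε := by ring
  have hprod : ∀ g f, M g f ∈ W := by
    intro g f
    change Tendsto (fun n => A n (M g f)) atTop (𝓝 (M g f))
    have h := (v.hasSum_repr g).tendsto_sum_nat
    simp only [v.repr_apply_apply] at h
    have h2 : Tendsto (fun n => M (∑ k ∈ Finset.range n, ⟪v k, g⟫_ℂ • v k) f) atTop
        (𝓝 (M g f)) :=
      ((M.flip f).continuous.tendsto g).comp h
    exact h2.congr fun n => (hM.sum_ampRankOne_apply ℕ (Finset.range n) v g f).symm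
  have htop : W = ⊤ := by
    have : CompleteSpace W := hWc.completeSpace_coe
    rw [← W.orthogonal_orthogonal, Submodule.orthogonal_eq_top_iff, Submodule.eq_bot_iff]
    intro x hx
    exact hM.dense x fun g f => (Submodule.mem_orthogonal _ _).1 hx _ (hprod g f)
  exact (htop ▸ Submodule.mem_top : x ∈ W)

end IsHilbertTensor

/-- Polarization: a closed subspace that contains `1 ⊗ |e z⟩⟨e z|` for all points of an entire
family `e` contains `1 ⊗ |g⟩⟨h|` for all `g` and `h`, provided the family `e` is total. -/
theorem ampRankOne_mem_of_entire (hM : IsHilbertTensor M) (W : Submodule ℂ (K →L[ℂ] K))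
    (hW : IsClosed (W : Set (K →L[ℂ] K))) {e : ℂ → E} (he : Differentiable ℂ e)
    (htot : (Submodule.span ℂ (Set.range e)).topologicalClosure = ⊤)
    (hd : ∀ z, ampRankOne M (e z) (e z) ∈ W) (g h : E) : ampRankOne M g h ∈ W := by
  by_cases hE : ∀ h₀ : E, h₀ = 0
  · have : ampRankOne M g h = 0 := by ext x; simp [ampRankOne_apply, hE g]
    rw [this]; exact zero_mem _
  push Not at hE
  obtain ⟨h₀, hh₀⟩ := hE
  -- The entire function `(z, w) ↦ ‖h₀‖² • (1 ⊗ |e z⟩⟨e (conj w)|)` of two variables.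
  let L : ℂ → K →L[ℂ] K := fun z => ampRankOneCLM M h₀ (e z)
  let R : ℂ → K →L[ℂ] K := star ∘ L ∘ (starRingEnd ℂ)
  have hL : Differentiable ℂ L := (ampRankOneCLM M h₀).differentiable.comp he
  have hR : Differentiable ℂ R := fun z =>
    (hasDerivAt_star_conj_iff.2 (by
      rw [star_star]; exact (hL (starRingEnd ℂ z)).hasDerivAt)
        : HasDerivAt R (star (deriv L (starRingEnd ℂ z))) z).differentiableAt
  have hLR : ∀ z w, L z * R w =
      (⟪h₀, h₀⟫_ℂ) • ampRankOne M (e z) (e (starRingEnd ℂ w)) := by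
    intro z w
    simp only [L, R, Function.comp_apply, ampRankOneCLM_apply, star_ampRankOne]
    exact hM.ampRankOne_mul _ _ _ _
  have hne : ⟪h₀, h₀⟫_ℂ ≠ 0 := inner_self_ne_zero.2 hh₀
  have key : ∀ a b : ℂ, L (a + Complex.I * b) * R (a - Complex.I * b) ∈ W := by
    intro a b
    have step : ∀ (y : ℝ) (a : ℂ), L (a + Complex.I * y) * R (a - Complex.I * y) ∈ W := by
      intro y
      refine mem_of_forall_real_mem W hW
        (f := fun a : ℂ => L (a + Complex.I * y) * R (a - Complex.I * y)) ?_ ?_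
      · exact (hL.comp (by fun_prop)).mul (hR.comp (by fun_prop))
      · intro x
        rw [hLR]
        refine W.smul_mem _ ?_
        have : (starRingEnd ℂ) ((x : ℂ) - Complex.I * y) = x + Complex.I * y := by
          simp
        rw [this]
        exact hd _
    refine mem_of_forall_real_mem W hW
        (f := fun b : ℂ => L (a + Complex.I * b) * R (a - Complex.I * b)) ?_ (fun y => step y a) b
    exact (hL.comp (by fun_prop)).mul (hR.comp (by fun_prop))
  have hee : ∀ z w, ampRankOne M (e z) (e w) ∈ W := by
    intro z w
    have h1 := key ((z + starRingEnd ℂ w) / 2) ((z - starRingEnd ℂ w) / (2 * Complex.I))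
    have hI : Complex.I * ((z - starRingEnd ℂ w) / (2 * Complex.I)) =
        (z - starRingEnd ℂ w) / 2 := by
      field_simp
    rw [hI, show (z + starRingEnd ℂ w) / 2 + (z - starRingEnd ℂ w) / 2 = z by ring,
      show (z + starRingEnd ℂ w) / 2 - (z - starRingEnd ℂ w) / 2 = starRingEnd ℂ w by ring,
      hLR, Complex.conj_conj] at h1
    exact (W.smul_mem_iff hne).1 h1
  -- Both slots extend from the family `e` to the whole space by linearity and continuity.
  have hext : ∀ (h : E), (∀ z, ampRankOne M (e z) h ∈ W) → ∀ g, ampRankOne M g h ∈ W := by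
    intro h hh g
    have hle : (Submodule.span ℂ (Set.range e)).topologicalClosure ≤
        W.comap (ampRankOneCLM M h).toLinearMap := by
      refine Submodule.topologicalClosure_minimal _ (Submodule.span_le.2 ?_)
        (hW.preimage (ampRankOneCLM M h).continuous)
      rintro _ ⟨z, rfl⟩
      exact hh z
    exact hle (htot ▸ Submodule.mem_top)
  have hge : ∀ g w, ampRankOne M g (e w) ∈ W := fun g w => hext (e w) (fun z => hee z w) g
  have hcl : IsClosed {h : E | ampRankOne M g h ∈ W} := by
    have hc : Continuous fun h : E => ampRankOne M g h := by
      have : (fun h : E => ampRankOne M g h) = fun h => star (ampRankOneCLM M g h) := by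
        ext h; rw [ampRankOneCLM_apply, star_ampRankOne]
      rw [this]
      exact (ampRankOneCLM M g).continuous.star
    exact hW.preimage hc
  have hsub : ∀ h ∈ Submodule.span ℂ (Set.range e), ampRankOne M g h ∈ W := by
    intro h hh
    induction hh using Submodule.span_induction with
    | mem x hx => obtain ⟨w, rfl⟩ := hx; exact hge g w
    | zero => 
      have : ampRankOne M g 0 = 0 := by ext x; simp [ampRankOne_apply]
      rw [this]; exact zero_mem _
    | add x y _ _ hx hy =>
      have : ampRankOne M g (x + y) = ampRankOne M g x + ampRankOne M g y := by
        ext z; simp [ampRankOne_apply]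
      rw [this]; exact add_mem hx hy
    | smul c x _ hx =>
      have : ampRankOne M g (c • x) = (starRingEnd ℂ c) • ampRankOne M g x := by
        rw [← star_ampRankOne, ampRankOne_smul_left, star_smul, star_ampRankOne]; rfl
      rw [this]; exact W.smul_mem _ hx
  have : h ∈ closure (Submodule.span ℂ (Set.range e) : Set E) := by
    rw [← Submodule.topologicalClosure_coe, htot]; trivial
  exact closure_minimal hsub hcl this

/-! ### The anticlique `1 ⊗ |g₀⟩⟨g₀|` -/

/-- If all generators are of the form `1 ⊗ |g⟩⟨g|`, then `1 ⊗ |g₀⟩⟨g₀|` compresses the closed span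
into its own multiples. -/
theorem mul_mul_eq_smul_of_mem_closedSpan (hM : IsHilbertTensor M) {S : Set (K →L[ℂ] K)}
    (hS : ∀ A ∈ S, ∃ g, A = ampRankOne M g g) {g₀ : E} {f₀ : F} (hf₀ : ‖f₀‖ = 1)
    {A : K →L[ℂ] K} (hA : A ∈ closedSpan S) :
    ampRankOne M g₀ g₀ * A * ampRankOne M g₀ g₀ =
      ⟪M g₀ f₀, A (M g₀ f₀)⟫_ℂ • ampRankOne M g₀ g₀ := by
  let W : Submodule ℂ (K →L[ℂ] K) :=
    { carrier := {A | ∀ f f' : F, ⟪M g₀ f, A (M g₀ f')⟫_ℂ =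
        ⟪M g₀ f₀, A (M g₀ f₀)⟫_ℂ * ⟪f, f'⟫_ℂ}
      add_mem' := fun {A B} hA hB f f' => by
        simp only [add_apply, inner_add_right, hA f f', hB f f', add_mul]
      zero_mem' := fun f f' => by simp
      smul_mem' := fun c A hA f f' => by
        simp only [smul_apply, inner_smul_right, hA f f', mul_assoc] }
  have hle : closedSpan S ≤ W := by
    refine closedSpan_le W ?_ ?_
    · intro A hA f f'
      obtain ⟨g, rfl⟩ := hS A hA
      simp only [ampRankOne_apply, hM.adjoint_apply_apply, map_smul, inner_smul_right,
        hM.inner_apply, inner_self_eq_norm_sq_to_K, hf₀]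
      simp
      ring
    · have : {B : K →WOT[ℂ] K | B.toCLM ∈ W} = ⋂ (f : F) (f' : F),
          {B : K →WOT[ℂ] K | ⟪M g₀ f, B (M g₀ f')⟫_ℂ =
            ⟪M g₀ f₀, B (M g₀ f₀)⟫_ℂ * ⟪f, f'⟫_ℂ} := by
        ext B; simp only [Set.mem_iInter]; rfl
      rw [this]
      refine isClosed_iInter fun f => isClosed_iInter fun f' => isClosed_eq ?_ ?_
      · exact ContinuousLinearMapWOT.continuous_inner_apply continuous_id _ _
      · exact (ContinuousLinearMapWOT.continuous_inner_apply continuous_id _ _).mul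
          continuous_const
  have hAW := hle hA
  refine ContinuousLinearMap.ext fun x => ext_inner_left ℂ fun y => ?_
  have h := hAW (adjoint (M g₀) y) (adjoint (M g₀) x)
  change ⟪y, M g₀ (adjoint (M g₀) (A (M g₀ (adjoint (M g₀) x))))⟫_ℂ =
    ⟪y, ⟪M g₀ f₀, A (M g₀ f₀)⟫_ℂ • M g₀ (adjoint (M g₀) x)⟫_ℂ
  rw [inner_smul_right, ← adjoint_inner_left (M g₀) _ y, ← adjoint_inner_left (M g₀) _ y, ← h,
    adjoint_inner_right]

/-- The closed span of operators `1 ⊗ |g⟩⟨g|` is a non-commutative graph with the maximal quantum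
anticlique `1 ⊗ |g₀⟩⟨g₀|` as soon as it contains all operators `1 ⊗ |g⟩⟨g|`. -/
theorem isMaximalQuantumAnticlique_ampRankOne (hM : IsHilbertTensor M) {S : Set (K →L[ℂ] K)}
    (hS : ∀ A ∈ S, ∃ g, A = ampRankOne M g g) (hmem : ∀ g, ampRankOne M g g ∈ closedSpan S)
    (v : HilbertBasis ℕ ℂ E) (w : HilbertBasis ℕ ℂ F) {g₀ : E} (hg₀ : ‖g₀‖ = 1) :
    IsNoncommutativeGraph (closedSpan S) ∧
    Orthonormal ℂ (fun k => M g₀ (w k)) ∧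
    (∀ x : K, HasSum (fun k => ⟪M g₀ (w k), x⟫_ℂ • M g₀ (w k)) (ampRankOne M g₀ g₀ x)) ∧
    Cardinal.aleph0 ≤ LinearMap.rank (ampRankOne M g₀ g₀ : K →ₗ[ℂ] K) ∧
    IsMaximalQuantumAnticlique (closedSpan S) (ampRankOne M g₀ g₀) := by
  have hone : (1 : K →L[ℂ] K) ∈ closedSpan S :=
    mem_closedSpan_of_tendsto (fun n => sum_mem fun k _ => hmem (v k))
      fun x => hM.tendsto_sum_ampRankOne v x
  have hgraph : IsNoncommutativeGraph (closedSpan S) := by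
    refine ⟨fun A hA => star_mem_closedSpan (fun A hA => ?_) hA, hone⟩
    obtain ⟨g, rfl⟩ := hS A hA
    rwa [star_ampRankOne]
  have horth : Orthonormal ℂ (fun k => M g₀ (w k)) := by
    rw [orthonormal_iff_ite]
    intro i j
    rw [hM.inner_apply, orthonormal_iff_ite.1 w.orthonormal, inner_self_eq_norm_sq_to_K, hg₀]
    simp
  have hproj := hM.isStarProjection_ampRankOne hg₀
  set P := ampRankOne M g₀ g₀ with hP
  have hrank : Cardinal.aleph0 ≤ LinearMap.rank (P : K →ₗ[ℂ] K) := by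
    have hli : LinearIndependent ℂ (fun k => M g₀ (w k)) := horth.linearIndependent
    have hin : ∀ k, M g₀ (w k) ∈ (P : K →ₗ[ℂ] K).range := fun k => by
      have : M g₀ (w k) ∈ (M g₀).range := ⟨w k, rfl⟩
      rw [← hM.range_ampRankOne hg₀] at this
      exact this
    have hli' : LinearIndependent ℂ
        (fun k => (⟨M g₀ (w k), hin k⟩ : (P : K →ₗ[ℂ] K).range)) :=
      LinearIndependent.of_comp (P : K →ₗ[ℂ] K).range.subtype hli
    simpa using hli'.cardinal_lift_le_rank
  have hP0 : P ≠ 0 := by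
    intro h
    rw [h, toLinearMap_zero, LinearMap.rank_zero] at hrank
    exact Cardinal.aleph0_ne_zero (le_antisymm hrank zero_le)
  have hsmul : ∀ A ∈ closedSpan S, ∃ c : ℂ, P * A * P = c • P := fun A hA =>
    ⟨_, mul_mul_eq_smul_of_mem_closedSpan hM hS (w.orthonormal.1 0) hA⟩
  refine ⟨hgraph, horth, fun x => ?_, hrank, ⟨⟨hproj, ?_, ?_⟩, ?_⟩⟩
  · have h := (w.hasSum_repr (adjoint (M g₀) x)).mapL (M g₀)
    simp only [w.repr_apply_apply, map_smul, adjoint_inner_right] at h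
    exact h
  · exact (Cardinal.natCast_le_aleph0 (n := 2)).trans hrank
  · have : compression P (closedSpan S) = Submodule.span ℂ {P} := by
      apply le_antisymm
      · rintro _ ⟨A, hA, rfl⟩
        obtain ⟨c, hc⟩ := hsmul A hA
        rw [LinearMap.mulLeftRight_apply, hc]
        exact Submodule.smul_mem _ _ (Submodule.mem_span_singleton_self P)
      · rw [Submodule.span_singleton_le_iff_mem]
        refine ⟨1, hone, ?_⟩
        rw [LinearMap.mulLeftRight_apply, mul_one]
        exact hproj.isIdempotentElem
    rw [this, finrank_span_singleton hP0]
  -- A larger anticlique `P'` satisfies `P' P P' = P`, and `P' V P'` is one-dimensional.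
  · rintro ⟨P', hP', hlt⟩
    have h1 : P' * P = P := (hproj.le_iff_mul_eq_right hP'.isStarProjection).1 hlt.le
    have h2 : P * P' = P := (hproj.le_iff_mul_eq_left hP'.isStarProjection).1 hlt.le
    have hPm : P ∈ compression P' (closedSpan S) :=
      ⟨P, hmem g₀, by rw [LinearMap.mulLeftRight_apply, h1, h2]⟩
    have hPm' : P' ∈ compression P' (closedSpan S) :=
      ⟨1, hone, by
        rw [LinearMap.mulLeftRight_apply, mul_one]
        exact hP'.isStarProjection.isIdempotentElem⟩
    obtain ⟨c, hc⟩ := (finrank_eq_one_iff_of_nonzero' (⟨P, hPm⟩ : compression P' (closedSpan S))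
      (by simpa [Subtype.ext_iff] using hP0)).1 hP'.finrank_compression ⟨P', hPm'⟩
    have hc' : c • P = P' := congrArg Subtype.val hc
    have : P = P' := by
      have h3 : c • P = P := by
        rw [← hc', smul_mul_assoc, hproj.isIdempotentElem.eq] at h1
        exact h1
      rw [← hc', h3]
    exact hlt.ne this

end Tensor

/-! ### Gaussians with polynomial factors -/

/-- The Gaussian `u ↦ P(u) exp (-a u² + b u)` with a polynomial factor. -/
def polyGaussFun (a b : ℂ) (P : Polynomial ℂ) (u : ℝ) : ℂ :=
  P.eval (u : ℂ) * Complex.exp (-a * u ^ 2 + b * u)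

open Polynomial in
/-- The polynomial factor of the derivative of `polyGaussFun a b P`. -/
def polyGaussDeriv (a b : ℂ) (P : Polynomial ℂ) : Polynomial ℂ :=
  derivative P + P * (C b - C (2 * a) * X)

theorem hasDerivAt_polyGaussFun (a b : ℂ) (P : Polynomial ℂ) (u : ℝ) :
    HasDerivAt (polyGaussFun a b P) (polyGaussFun a b (polyGaussDeriv a b P) u) u := by
  have h1 : HasDerivAt (fun u : ℝ => P.eval (u : ℂ)) (P.derivative.eval (u : ℂ)) u :=
    (P.hasDerivAt (u : ℂ)).comp_ofReal
  have h2 : HasDerivAt (fun z : ℂ => Complex.exp (-a * z ^ 2 + b * z))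
      (Complex.exp (-a * (u : ℂ) ^ 2 + b * u) * (-a * (2 * u) + b)) u := by
    have h3 : HasDerivAt (fun z : ℂ => -a * z ^ 2 + b * z) (-a * (2 * u) + b) (u : ℂ) := by
      have := ((hasDerivAt_pow 2 (u : ℂ)).const_mul (-a)).add ((hasDerivAt_id (u : ℂ)).const_mul b)
      refine this.congr_deriv ?_
      norm_num
    exact h3.cexp
  refine (h1.mul h2.comp_ofReal).congr_deriv ?_
  simp [polyGaussFun, polyGaussDeriv]
  ring

theorem contDiff_polyGaussFun (a b : ℂ) (P : Polynomial ℂ) {n : WithTop ℕ∞} :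
    ContDiff ℝ n (polyGaussFun a b P) := by
  have h1 : ContDiff ℝ n (fun u : ℝ => (u : ℂ)) := Complex.ofRealCLM.contDiff
  have h2 : ContDiff ℝ n (fun u : ℝ => P.eval (u : ℂ)) := by
    have h := ((P.contDiff_aeval (𝕜 := ℂ) n).restrict_scalars ℝ).comp h1
    simpa [Function.comp_def] using h
  exact h2.mul (((contDiff_const.mul (h1.pow 2)).add (contDiff_const.mul h1)).cexp)

theorem iteratedDeriv_polyGaussFun (a b : ℂ) (n : ℕ) (P : Polynomial ℂ) :
    iteratedDeriv n (polyGaussFun a b P) = polyGaussFun a b ((polyGaussDeriv a b)^[n] P) := by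
  induction n generalizing P with
  | zero => simp
  | succ n ih =>
    rw [iteratedDeriv_succ']
    have : deriv (polyGaussFun a b P) = polyGaussFun a b (polyGaussDeriv a b P) :=
      funext fun u => (hasDerivAt_polyGaussFun a b P u).deriv
    rw [this, ih, Function.iterate_succ_apply]

theorem norm_gauss (a b : ℂ) (u : ℝ) :
    ‖Complex.exp (-a * u ^ 2 + b * u)‖ = Real.exp (-a.re * u ^ 2 + b.re * u) := by
  rw [Complex.norm_exp]
  congr 1
  have : (-a * (u : ℂ) ^ 2 + b * u) = ((u ^ 2 : ℝ) : ℂ) * (-a) + (u : ℂ) * b := by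
    push_cast; ring
  rw [this, Complex.add_re, Complex.re_ofReal_mul, Complex.re_ofReal_mul, Complex.neg_re]
  ring

theorem exists_pow_mul_gauss_le {a : ℂ} (ha : 0 < a.re) (b : ℂ) (m : ℕ) :
    ∃ C, ∀ u : ℝ, |u| ^ m * ‖Complex.exp (-a * u ^ 2 + b * u)‖ ≤ C := by
  refine ⟨m.factorial * Real.exp ((1 + |b.re|) ^ 2 / (4 * a.re)), fun u => ?_⟩
  have h1 : |u| ^ m ≤ m.factorial * Real.exp |u| := by
    have := Real.pow_div_factorial_le_exp |u| (abs_nonneg u) m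
    rwa [div_le_iff₀' (by positivity)] at this
  rw [norm_gauss]
  calc |u| ^ m * Real.exp (-a.re * u ^ 2 + b.re * u)
      ≤ m.factorial * Real.exp |u| * Real.exp (-a.re * u ^ 2 + b.re * u) := by gcongr
    _ = m.factorial * Real.exp (|u| + (-a.re * u ^ 2 + b.re * u)) := by
      rw [mul_assoc, ← Real.exp_add]
    _ ≤ _ := by
      gcongr
      rw [le_div_iff₀ (by positivity)]
      have h2 : b.re * u ≤ |b.re| * |u| := by rw [← abs_mul]; exact le_abs_self _
      have h3 : u ^ 2 = |u| ^ 2 := (sq_abs u).symm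
      rw [h3]
      nlinarith [sq_nonneg (2 * a.re * |u| - (1 + |b.re|))]

theorem exists_pow_mul_polyGaussFun_le {a : ℂ} (ha : 0 < a.re) (b : ℂ) (P : Polynomial ℂ) (k : ℕ) :
    ∃ C, ∀ u : ℝ, |u| ^ k * ‖polyGaussFun a b P u‖ ≤ C := by
  induction P using Polynomial.induction_on' with
  | add p q hp hq =>
    obtain ⟨C, hC⟩ := hp
    obtain ⟨D, hD⟩ := hq
    refine ⟨C + D, fun u => ?_⟩
    have : polyGaussFun a b (p + q) u = polyGaussFun a b p u + polyGaussFun a b q u := by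
      simp [polyGaussFun, add_mul]
    rw [this]
    calc |u| ^ k * ‖polyGaussFun a b p u + polyGaussFun a b q u‖
        ≤ |u| ^ k * (‖polyGaussFun a b p u‖ + ‖polyGaussFun a b q u‖) := by
          gcongr; exact norm_add_le _ _
      _ ≤ C + D := by rw [mul_add]; exact add_le_add (hC u) (hD u)
  | monomial n c =>
    obtain ⟨C, hC⟩ := exists_pow_mul_gauss_le ha b (k + n)
    refine ⟨‖c‖ * C, fun u => ?_⟩
    have := mul_le_mul_of_nonneg_left (hC u) (norm_nonneg c)
    refine le_trans (le_of_eq ?_) this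
    simp only [polyGaussFun, Polynomial.eval_monomial, norm_mul, norm_pow, Complex.norm_real,
      Real.norm_eq_abs]
    ring

/-- `polyGaussFun` as a Schwartz function. -/
def polyGauss (a b : ℂ) (ha : 0 < a.re) (P : Polynomial ℂ) : 𝓢(ℝ, ℂ) where
  toFun := polyGaussFun a b P
  smooth' := contDiff_polyGaussFun a b P
  decay' k n := by
    simp only [norm_iteratedFDeriv_eq_norm_iteratedDeriv, iteratedDeriv_polyGaussFun,
      Real.norm_eq_abs]
    exact exists_pow_mul_polyGaussFun_le ha b _ k

theorem polyGauss_apply (a b : ℂ) (ha : 0 < a.re) (P : Polynomial ℂ) (u : ℝ) :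
    polyGauss a b ha P u = polyGaussFun a b P u := rfl

open Classical in
/-- The Gaussian `u ↦ P(u) exp (-a u² + b u)` as an element of `L²(ℝ)`; it is `0` if `a` does not have
positive real part. -/
def polyGaussLp (a b : ℂ) (P : Polynomial ℂ) : L2R :=
  if ha : 0 < a.re then (polyGauss a b ha P).toLp 2 volume else 0

theorem polyGaussLp_eq {a : ℂ} (ha : 0 < a.re) (b : ℂ) (P : Polynomial ℂ) :
    polyGaussLp a b P = (polyGauss a b ha P).toLp 2 volume := dif_pos ha

theorem coeFn_polyGaussLp {a : ℂ} (ha : 0 < a.re) (b : ℂ) (P : Polynomial ℂ) :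
    polyGaussLp a b P =ᵐ[volume] polyGaussFun a b P := by
  rw [polyGaussLp_eq ha]
  exact SchwartzMap.coeFn_toLp _ _ _

/-- `u ↦ exp (-a u² + b u)` as an element of `L²(ℝ)`. -/
abbrev gaussLp (a b : ℂ) : L2R := polyGaussLp a b 1

theorem coeFn_gaussLp {a : ℂ} (ha : 0 < a.re) (b : ℂ) :
    gaussLp a b =ᵐ[volume] fun u : ℝ => Complex.exp (-a * u ^ 2 + b * u) := by
  filter_upwards [coeFn_polyGaussLp ha b 1] with u hu
  rw [hu]; simp [polyGaussFun]

/-! ### Holomorphic dependence of Gaussians on their parameters -/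

/-- The second order Taylor bound for the exponential, weighted by a Gaussian; the right-hand side
is the value at `u` of a fixed element of `L²(ℝ)` times the square of the increment. -/
theorem norm_gauss_taylor_le {a b α β : ℂ} {ε : ℝ} (hα : ‖α‖ ≤ ε) (hβ : ‖β‖ ≤ ε) {η : ℝ}
    (hαη : ‖α‖ ≤ η) (hβη : ‖β‖ ≤ η) (u : ℝ) :
    ‖Complex.exp (-(a + α) * u ^ 2 + (b + β) * u) - Complex.exp (-a * u ^ 2 + b * u)
        - (-α * u ^ 2 + β * u) * Complex.exp (-a * u ^ 2 + b * u)‖ ≤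
      η ^ 2 * ((2 * u ^ 4 + 2 * u ^ 2) *
        (Real.exp (-(a.re - ε) * u ^ 2 + (|b.re| + ε) * u) +
          Real.exp (-(a.re - ε) * u ^ 2 + -(|b.re| + ε) * u))) := by
  set δ : ℂ := -α * u ^ 2 + β * u with hδ
  have hη : 0 ≤ η := (norm_nonneg _).trans hαη
  have e1 : Complex.exp (-(a + α) * u ^ 2 + (b + β) * u) =
      Complex.exp (-a * u ^ 2 + b * u) * Complex.exp δ := by
    rw [← Complex.exp_add]; congr 1; rw [hδ]; ring
  have e2 : Complex.exp (-a * u ^ 2 + b * u) * Complex.exp δ - Complex.exp (-a * u ^ 2 + b * u)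
        - δ * Complex.exp (-a * u ^ 2 + b * u) =
      Complex.exp (-a * u ^ 2 + b * u) *
        (Complex.exp δ - ∑ m ∈ Finset.range 2, δ ^ m / (m.factorial : ℂ)) := by
    simp [Finset.sum_range_succ]; ring
  have hδn : ∀ c, ‖α‖ ≤ c → ‖β‖ ≤ c → ‖δ‖ ≤ c * u ^ 2 + c * |u| := by
    intro c h1 h2
    refine (norm_add_le _ _).trans ?_
    rw [norm_mul, norm_mul, norm_neg, norm_pow, Complex.norm_real, Real.norm_eq_abs, sq_abs]
    gcongr
  have h3 : ‖δ‖ ^ 2 ≤ η ^ 2 * (2 * u ^ 4 + 2 * u ^ 2) := by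
    calc ‖δ‖ ^ 2 ≤ (η * u ^ 2 + η * |u|) ^ 2 := by gcongr; exact hδn η hαη hβη
      _ = η ^ 2 * (u ^ 2 + |u|) ^ 2 := by ring
      _ ≤ _ := by
        gcongr
        have : u ^ 4 = (u ^ 2) ^ 2 := by ring
        nlinarith [sq_nonneg (u ^ 2 - |u|), sq_abs u]
  have h4 : Real.exp (-a.re * u ^ 2 + b.re * u) * Real.exp ‖δ‖ ≤
      Real.exp (-(a.re - ε) * u ^ 2 + (|b.re| + ε) * u) +
          Real.exp (-(a.re - ε) * u ^ 2 + -(|b.re| + ε) * u) := by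
    rw [← Real.exp_add]
    have h5 : b.re * u ≤ |b.re| * |u| := by rw [← abs_mul]; exact le_abs_self _
    have h6 := hδn ε hα hβ
    have h7 : -a.re * u ^ 2 + b.re * u + ‖δ‖ ≤ -(a.re - ε) * u ^ 2 + (|b.re| + ε) * |u| := by
      linarith
    refine (Real.exp_le_exp.2 h7).trans ?_
    rcases abs_cases u with ⟨h, _⟩ | ⟨h, _⟩ <;> rw [h]
    · exact le_add_of_nonneg_right (Real.exp_pos _).le
    · rw [mul_neg, ← neg_mul]; exact le_add_of_nonneg_left (Real.exp_pos _).le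
  rw [e1, e2, norm_mul, norm_gauss]
  calc Real.exp (-a.re * u ^ 2 + b.re * u) *
        ‖Complex.exp δ - ∑ m ∈ Finset.range 2, δ ^ m / (m.factorial : ℂ)‖
      ≤ Real.exp (-a.re * u ^ 2 + b.re * u) * (‖δ‖ ^ 2 * Real.exp ‖δ‖) := by
        gcongr; exact Complex.norm_exp_sub_sum_le_norm_mul_exp δ 2
    _ = ‖δ‖ ^ 2 * (Real.exp (-a.re * u ^ 2 + b.re * u) * Real.exp ‖δ‖) := by ring
    _ ≤ (η ^ 2 * (2 * u ^ 4 + 2 * u ^ 2)) * _ := mul_le_mul h3 h4 (by positivity) (by positivity)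
    _ = _ := by ring

open Polynomial in
/-- The Gaussian `exp (-a u² + b u)` is a holomorphic function of `(a, b)` with values in
`L²(ℝ)`. -/
theorem hasFDerivAt_gaussLp {a : ℂ} (ha : 0 < a.re) (b : ℂ) :
    HasFDerivAt (fun p : ℂ × ℂ => gaussLp p.1 p.2)
      ((ContinuousLinearMap.fst ℂ ℂ ℂ).smulRight (-polyGaussLp a b (X ^ 2)) +
        (ContinuousLinearMap.snd ℂ ℂ ℂ).smulRight (polyGaussLp a b X)) (a, b) := by
  rw [hasFDerivAt_iff_isLittleO_nhds_zero]
  set ε : ℝ := a.re / 2 with hε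
  have hε0 : 0 < ε := by positivity
  have hc : 0 < ((a.re - ε : ℝ) : ℂ).re := by rw [Complex.ofReal_re, hε]; linarith
  let G : L2R := polyGaussLp ((a.re - ε : ℝ) : ℂ) ((|b.re| + ε : ℝ) : ℂ) (2 * X ^ 4 + 2 * X ^ 2) +
    polyGaussLp ((a.re - ε : ℝ) : ℂ) ((-(|b.re| + ε) : ℝ) : ℂ) (2 * X ^ 4 + 2 * X ^ 2)
  refine Asymptotics.IsBigO.trans_isLittleO (g := fun h : ℂ × ℂ => ‖h‖ ^ 2) ?_
    (Asymptotics.isLittleO_norm_pow_id one_lt_two)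
  refine Asymptotics.IsBigO.of_bound ‖G‖ ?_
  have hball : ∀ᶠ h : ℂ × ℂ in 𝓝 0, ‖h‖ < ε := by
    have := Metric.ball_mem_nhds (0 : ℂ × ℂ) hε0
    filter_upwards [this] with h hh
    simpa using hh
  filter_upwards [hball] with h hh
  have h1 : ‖h.1‖ ≤ ‖h‖ := norm_fst_le h
  have h2 : ‖h.2‖ ≤ ‖h‖ := norm_snd_le h
  have ha' : 0 < (a + h.1).re := by
    have := (abs_le.1 (Complex.abs_re_le_norm h.1)).1
    rw [Complex.add_re]; rw [hε] at hh; linarith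
  have hn : ‖‖h‖ ^ 2‖ = ‖h‖ ^ 2 := by rw [norm_pow, norm_norm]
  rw [hn]
  have key : ‖gaussLp (a + h.1) (b + h.2) - gaussLp a b -
      (h.1 • (-polyGaussLp a b (X ^ 2)) + h.2 • polyGaussLp a b X)‖ ≤ ‖(‖h‖ ^ 2 : ℝ) • G‖ := by
    refine Lp.norm_le_norm_of_ae_le ?_
    filter_upwards [coeFn_gaussLp ha' (b + h.2), coeFn_gaussLp ha b,
      coeFn_polyGaussLp ha b (X ^ 2), coeFn_polyGaussLp ha b X,
      coeFn_polyGaussLp hc ((|b.re| + ε : ℝ) : ℂ) (2 * X ^ 4 + 2 * X ^ 2),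
      coeFn_polyGaussLp hc ((-(|b.re| + ε) : ℝ) : ℂ) (2 * X ^ 4 + 2 * X ^ 2),
      Lp.coeFn_sub (gaussLp (a + h.1) (b + h.2) - gaussLp a b)
        (h.1 • (-polyGaussLp a b (X ^ 2)) + h.2 • polyGaussLp a b X),
      Lp.coeFn_sub (gaussLp (a + h.1) (b + h.2)) (gaussLp a b),
      Lp.coeFn_add (h.1 • (-polyGaussLp a b (X ^ 2))) (h.2 • polyGaussLp a b X),
      Lp.coeFn_smul h.1 (-polyGaussLp a b (X ^ 2)), Lp.coeFn_smul h.2 (polyGaussLp a b X),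
      Lp.coeFn_neg (polyGaussLp a b (X ^ 2)), Lp.coeFn_smul (‖h‖ ^ 2 : ℝ) G,
      Lp.coeFn_add (polyGaussLp ((a.re - ε : ℝ) : ℂ) ((|b.re| + ε : ℝ) : ℂ)
        (2 * X ^ 4 + 2 * X ^ 2)) (polyGaussLp ((a.re - ε : ℝ) : ℂ) ((-(|b.re| + ε) : ℝ) : ℂ)
        (2 * X ^ 4 + 2 * X ^ 2))] with u g1 g2 g3 g4 g5 g6 s1 s2 s3 s4 s5 s6 s7 s8
    rw [s1, Pi.sub_apply, s2, Pi.sub_apply, s3, Pi.add_apply, s4, Pi.smul_apply, s5, Pi.smul_apply,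
      s6, Pi.neg_apply, s7, Pi.smul_apply, s8, Pi.add_apply, g1, g2, g3, g4, g5, g6]
    have ht := norm_gauss_taylor_le (a := a) (b := b) (h1.trans hh.le) (h2.trans hh.le) h1 h2 u
    have hr : ‖(‖h‖ ^ 2 : ℝ) • (polyGaussFun ((a.re - ε : ℝ) : ℂ) ((|b.re| + ε : ℝ) : ℂ)
          (2 * X ^ 4 + 2 * X ^ 2) u + polyGaussFun ((a.re - ε : ℝ) : ℂ)
          ((-(|b.re| + ε) : ℝ) : ℂ) (2 * X ^ 4 + 2 * X ^ 2) u)‖ =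
        ‖h‖ ^ 2 * ((2 * u ^ 4 + 2 * u ^ 2) *
        (Real.exp (-(a.re - ε) * u ^ 2 + (|b.re| + ε) * u) +
          Real.exp (-(a.re - ε) * u ^ 2 + -(|b.re| + ε) * u))) := by
      have : (‖h‖ ^ 2 : ℝ) • (polyGaussFun ((a.re - ε : ℝ) : ℂ) ((|b.re| + ε : ℝ) : ℂ)
          (2 * X ^ 4 + 2 * X ^ 2) u + polyGaussFun ((a.re - ε : ℝ) : ℂ)
          ((-(|b.re| + ε) : ℝ) : ℂ) (2 * X ^ 4 + 2 * X ^ 2) u) =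
          ((‖h‖ ^ 2 * ((2 * u ^ 4 + 2 * u ^ 2) *
        (Real.exp (-(a.re - ε) * u ^ 2 + (|b.re| + ε) * u) +
          Real.exp (-(a.re - ε) * u ^ 2 + -(|b.re| + ε) * u))) : ℝ) : ℂ) := by
        simp only [polyGaussFun, Complex.real_smul]
        push_cast
        simp
        left
        ring
      rw [this, Complex.norm_real, Real.norm_eq_abs, abs_of_nonneg (by positivity)]
    rw [hr]
    refine le_trans (le_of_eq ?_) ht
    congr 1
    simp [polyGaussFun]
    ring
  refine le_trans (le_of_eq ?_) (key.trans (le_of_eq ?_))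
  · simp
  · rw [norm_smul, hn, mul_comm]

theorem differentiable_gaussLp {a : ℂ} (ha : 0 < a.re) (c : ℂ) :
    Differentiable ℂ fun z : ℂ => gaussLp a (c * z) := by
  intro z
  have h1 : DifferentiableAt ℂ (fun z : ℂ => ((a, c * z) : ℂ × ℂ)) z := by fun_prop
  exact DifferentiableAt.comp (g := fun p : ℂ × ℂ => gaussLp p.1 p.2) z
    (hasFDerivAt_gaussLp ha (c * z)).differentiableAt h1

open Polynomial in
/-- The time derivative of `exp (-a u² + b u + c)` for time-dependent parameters. -/
theorem hasDerivAt_exp_smul_gaussLp {a b c : ℝ → ℂ} {a' b' c' : ℂ} {t : ℝ} (ha : 0 < (a t).re)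
    (hda : HasDerivAt a a' t) (hdb : HasDerivAt b b' t) (hdc : HasDerivAt c c' t) :
    HasDerivAt (fun s => Complex.exp (c s) • gaussLp (a s) (b s))
      (Complex.exp (c t) • polyGaussLp (a t) (b t) (C (-a') * X ^ 2 + C b' * X + C c')) t := by
  have h1 := ((hasFDerivAt_gaussLp ha (b t)).restrictScalars ℝ).comp_hasDerivAt t (hda.prodMk hdb)
  have h2 := hdc.cexp.smul h1
  refine h2.congr_deriv ?_
  apply Lp.ext
  filter_upwards [coeFn_polyGaussLp ha (b t) (C (-a') * X ^ 2 + C b' * X + C c'),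
    coeFn_polyGaussLp ha (b t) (X ^ 2), coeFn_polyGaussLp ha (b t) X,
    coeFn_polyGaussLp ha (b t) 1,
    Lp.coeFn_smul (Complex.exp (c t))
      (polyGaussLp (a t) (b t) (C (-a') * X ^ 2 + C b' * X + C c')),
    Lp.coeFn_add (Complex.exp (c t) • (a' • (-polyGaussLp (a t) (b t) (X ^ 2)) +
      b' • polyGaussLp (a t) (b t) X)) ((Complex.exp (c t) * c') • gaussLp (a t) (b t)),
    Lp.coeFn_smul (Complex.exp (c t)) (a' • (-polyGaussLp (a t) (b t) (X ^ 2)) +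
      b' • polyGaussLp (a t) (b t) X),
    Lp.coeFn_smul (Complex.exp (c t) * c') (gaussLp (a t) (b t)),
    Lp.coeFn_add (a' • (-polyGaussLp (a t) (b t) (X ^ 2))) (b' • polyGaussLp (a t) (b t) X),
    Lp.coeFn_smul a' (-polyGaussLp (a t) (b t) (X ^ 2)),
    Lp.coeFn_smul b' (polyGaussLp (a t) (b t) X),
    Lp.coeFn_neg (polyGaussLp (a t) (b t) (X ^ 2))] with u g1 g2 g3 g4 s1 s2 s3 s4 s5 s6 s7 s8
  rw [s1, Pi.smul_apply, g1]
  refine Eq.trans s2 ?_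
  rw [Pi.add_apply, s3, Pi.smul_apply, s4, Pi.smul_apply, s5, Pi.add_apply, s6, Pi.smul_apply, s7,
    Pi.smul_apply, s8, Pi.neg_apply, g2, g3, g4]
  simp [polyGaussFun]
  ring

/-! ### Inner products and totality of Gaussians -/

theorem inner_gaussLp {a : ℝ} (ha : 0 < a) (b b' : ℂ) :
    ⟪gaussLp a b, gaussLp a b'⟫_ℂ =
      (√(Real.pi / (2 * a)) : ℂ) * Complex.exp ((starRingEnd ℂ b + b') ^ 2 / (8 * a)) := by
  have ha' : 0 < (a : ℂ).re := by simpa using ha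
  rw [L2.inner_def]
  have h1 : ∫ u, ⟪(gaussLp a b : ℝ → ℂ) u, (gaussLp a b' : ℝ → ℂ) u⟫_ℂ =
      ∫ u : ℝ, Complex.exp (((-(2 * a) : ℝ) : ℂ) * u ^ 2 + (starRingEnd ℂ b + b') * u + 0) := by
    refine integral_congr_ae ?_
    filter_upwards [coeFn_gaussLp ha' b, coeFn_gaussLp ha' b'] with u h1 h2
    rw [h1, h2, RCLike.inner_apply, ← Complex.exp_conj, ← Complex.exp_add]
    congr 1
    simp
    ring
  rw [h1, integral_cexp_quadratic (by rw [Complex.ofReal_re]; linarith)]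
  congr 1
  · rw [← Complex.ofReal_neg, neg_neg, ← Complex.ofReal_div, Real.sqrt_eq_rpow,
      Complex.ofReal_cpow (by positivity)]
    norm_num
  · congr 1
    have : (a : ℂ) ≠ 0 := by exact_mod_cast ha.ne'
    push_cast
    field_simp
    ring

open FourierTransform in
/-- An integrable function on the line with vanishing Fourier transform vanishes almost
everywhere. -/
theorem ae_eq_zero_of_fourier_eq_zero {F : ℝ → ℂ} (hF : Integrable F) (h : ∀ ξ, 𝓕 F ξ = 0) :
    F =ᵐ[volume] 0 := by
  refine ae_eq_zero_of_integral_contDiff_smul_eq_zero hF.locallyIntegrable fun g hg hgs => ?_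
  have hgc : HasCompactSupport (fun x => (g x : ℂ)) := hgs.comp_left (g := Complex.ofReal) (by simp)
  let φ : 𝓢(ℝ, ℂ) := hgc.toSchwartzMap (Complex.ofRealCLM.contDiff.comp hg)
  let ψ : 𝓢(ℝ, ℂ) := 𝓕⁻ φ
  have h1 : ∀ x, 𝓕 ψ x = (g x : ℂ) := fun x => by
    rw [FourierTransform.fourier_fourierInv_eq]; rfl
  have h2 := VectorFourier.integral_fourierIntegral_smul_eq_flip (μ := volume) (ν := volume)
    (L := innerₗ ℝ) Real.continuous_fourierChar continuous_inner hF ψ.integrable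
  have h3 : ∀ ξ, VectorFourier.fourierIntegral Real.fourierChar volume (innerₗ ℝ) F ξ = 0 := h
  have h4 : ∀ x, VectorFourier.fourierIntegral Real.fourierChar volume (innerₗ ℝ).flip
      ψ x = (g x : ℂ) := by
    intro x
    rw [← h1 x, SchwartzMap.fourier_coe, flip_innerₗ]
    rfl
  simp only [h3, h4, smul_eq_mul, zero_mul, integral_zero] at h2
  rw [h2]
  exact integral_congr_ae (Eventually.of_forall fun x => by simp [mul_comm])

/-- Up to a conjugate Gaussian factor, the inner products of `f` with the Gaussians
`exp (-a u² + 2πiξ u)` are the values of a Fourier transform. -/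
theorem eq_zero_of_inner_gaussLp {a : ℂ} (ha : 0 < a.re) {f : L2R}
    (h : ∀ b, ⟪gaussLp a b, f⟫_ℂ = 0) : f = 0 := by
  let F : ℝ → ℂ := fun u => starRingEnd ℂ ((gaussLp a 0 : ℝ → ℂ) u) * f u
  have hF : Integrable F := by
    have := L2.integrable_inner (𝕜 := ℂ) (gaussLp a 0) f
    refine this.congr (Eventually.of_forall fun u => ?_)
    simp only [F, RCLike.inner_apply]
    ring
  have h0 : F =ᵐ[volume] 0 := by
    refine ae_eq_zero_of_fourier_eq_zero hF fun ξ => ?_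
    rw [Real.fourier_eq', ← h (2 * Real.pi * ξ * Complex.I), L2.inner_def]
    refine integral_congr_ae ?_
    filter_upwards [coeFn_gaussLp ha 0, coeFn_gaussLp ha (2 * Real.pi * ξ * Complex.I)]
      with u h1 h2
    simp only [F, h1, h2, RCLike.inner_apply, smul_eq_mul, ← Complex.exp_conj]
    rw [← mul_assoc, ← Complex.exp_add, mul_comm (f u)]
    congr 2
    simp [Complex.conj_ofNat]
    ring
  apply Lp.ext
  filter_upwards [h0, coeFn_gaussLp ha 0, Lp.coeFn_zero ℂ 2 (volume : Measure ℝ)] with u h1 h2 h3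
  rw [h3]
  simp only [F, h2, Pi.zero_apply, mul_eq_zero, map_eq_zero, Complex.exp_ne_zero, false_or] at h1
  exact h1

/-- The Gaussians of a fixed width are total in `L²(ℝ)`. -/
theorem topologicalClosure_span_gaussLp {a : ℂ} (ha : 0 < a.re) {c : ℂ} (hc : c ≠ 0) :
    (Submodule.span ℂ (Set.range fun z : ℂ => gaussLp a (c * z))).topologicalClosure = ⊤ := by
  rw [Submodule.topologicalClosure_eq_top_iff, Submodule.eq_bot_iff]
  intro f hf
  refine eq_zero_of_inner_gaussLp ha fun b => ?_
  refine (Submodule.mem_orthogonal _ _).1 hf _ (Submodule.subset_span ⟨b / c, ?_⟩)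
  simp only
  rw [mul_div_cancel₀ _ hc]

/-! ### The two modes as a Hilbert tensor product -/

/-- The orthogonal change of variables `(x, y) ↦ ((x + y) / √2, (x - y) / √2)`. -/
def rotEquiv : (ℝ × ℝ) ≃L[ℝ] ℝ × ℝ := sumDiffEquiv √2 (by positivity)

theorem rotEquiv_apply (p : ℝ × ℝ) : rotEquiv p = ((p.1 + p.2) / √2, (p.1 - p.2) / √2) := rfl

theorem sumDiff_eq (f g : ℝ → ℂ) (p : ℝ × ℝ) :
    sumDiff √2 f g p = f (rotEquiv p).1 * g (rotEquiv p).2 := rfl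

theorem rotEquiv_rotEquiv (p : ℝ × ℝ) : rotEquiv (rotEquiv p) = p := by
  have h : √2 * √2 = 2 := Real.mul_self_sqrt (by norm_num)
  have h0 : √2 ≠ 0 := by positivity
  simp only [rotEquiv_apply]
  ext
  · simp only; field_simp; rw [Real.sq_sqrt (by norm_num)]; ring
  · simp only; field_simp; rw [Real.sq_sqrt (by norm_num)]; ring

/-- The change of variables is its own inverse, so its determinant has absolute value one. -/
theorem measurePreserving_rotEquiv :
    MeasurePreserving rotEquiv.toHomeomorph.toMeasurableEquiv
      (volume : Measure (ℝ × ℝ)) volume := by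
  refine ⟨rotEquiv.toHomeomorph.toMeasurableEquiv.measurable, ?_⟩
  set T : (ℝ × ℝ) →ₗ[ℝ] ℝ × ℝ := (rotEquiv.toLinearEquiv : (ℝ × ℝ) →ₗ[ℝ] ℝ × ℝ) with hT
  have hTT : T * T = 1 := LinearMap.ext fun p => rotEquiv_rotEquiv p
  have hd : LinearMap.det T * LinearMap.det T = 1 := by rw [← map_mul, hTT, map_one]
  have habs : |(LinearMap.det T)⁻¹| = 1 := by
    rcases mul_self_eq_one_iff.1 hd with h | h <;> rw [h] <;> simp
  have hdet : LinearMap.det T ≠ 0 := fun h => by simp [h] at hd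
  have hmap := Measure.map_linearMap_addHaar_eq_smul_addHaar (volume : Measure (ℝ × ℝ)) hdet
  rw [habs, ENNReal.ofReal_one, one_smul] at hmap
  exact hmap

theorem ae_comp_rotEquiv_fst {p : ℝ → Prop} (h : ∀ᵐ u, p u) :
    ∀ᵐ q : ℝ × ℝ, p (rotEquiv q).1 :=
  measurePreserving_rotEquiv.quasiMeasurePreserving.ae
    ((Measure.quasiMeasurePreserving_fst (μ := volume) (ν := volume)).ae h)

theorem ae_comp_rotEquiv_snd {p : ℝ → Prop} (h : ∀ᵐ u, p u) :
    ∀ᵐ q : ℝ × ℝ, p (rotEquiv q).2 :=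
  measurePreserving_rotEquiv.quasiMeasurePreserving.ae
    ((Measure.quasiMeasurePreserving_snd (μ := volume) (ν := volume)).ae h)

theorem coeFn_modeProduct {f g : L2R} {f₀ g₀ : ℝ → ℂ} (hf : f =ᵐ[volume] f₀)
    (hg : g =ᵐ[volume] g₀) : modeProduct f g =ᵐ[volume] sumDiff √2 f₀ g₀ := by
  filter_upwards [MemLp.coeFn_toLp (memLp_sumDiff (c := √2) (by positivity) (Lp.memLp f)
    (Lp.memLp g)), ae_comp_rotEquiv_fst hf, ae_comp_rotEquiv_snd hg] with q h1 h2 h3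
  rw [modeProduct, h1, sumDiff_eq, sumDiff_eq, h2, h3]

theorem inner_modeProduct (f g f' g' : L2R) :
    ⟪modeProduct f g, modeProduct f' g'⟫_ℂ = ⟪g, g'⟫_ℂ * ⟪f, f'⟫_ℂ := by
  rw [L2.inner_def, L2.inner_def, L2.inner_def]
  have h1 : ∫ q, ⟪(modeProduct f g : ℝ × ℝ → ℂ) q, (modeProduct f' g' : ℝ × ℝ → ℂ) q⟫_ℂ =
      ∫ q : ℝ × ℝ, (fun p : ℝ × ℝ => ⟪f p.1, f' p.1⟫_ℂ * ⟪g p.2, g' p.2⟫_ℂ)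
        (rotEquiv.toHomeomorph.toMeasurableEquiv q) := by
    refine integral_congr_ae ?_
    filter_upwards [coeFn_modeProduct (f := f) (g := g) ae_eq_rfl ae_eq_rfl,
      coeFn_modeProduct (f := f') (g := g') ae_eq_rfl ae_eq_rfl] with q h1 h2
    rw [h1, h2, sumDiff_eq, sumDiff_eq]
    change _ = ⟪f (rotEquiv q).1, f' (rotEquiv q).1⟫_ℂ * ⟪g (rotEquiv q).2, g' (rotEquiv q).2⟫_ℂ
    simp only [RCLike.inner_apply, map_mul]
    ring
  rw [h1, measurePreserving_rotEquiv.integral_comp'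
      (fun p : ℝ × ℝ => ⟪f p.1, f' p.1⟫_ℂ * ⟪g p.2, g' p.2⟫_ℂ), Measure.volume_eq_prod, mul_comm,
    integral_prod_mul (fun u => ⟪f u, f' u⟫_ℂ) (fun u => ⟪g u, g' u⟫_ℂ)]

theorem norm_modeProduct (f g : L2R) : ‖modeProduct f g‖ = ‖g‖ * ‖f‖ := by
  have h := inner_modeProduct f g f g
  simp only [inner_self_eq_norm_sq_to_K] at h
  have h2 : ‖modeProduct f g‖ ^ 2 = (‖g‖ * ‖f‖) ^ 2 := by
    rw [mul_pow]; exact_mod_cast h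
  exact (pow_left_inj₀ (norm_nonneg _) (by positivity) two_ne_zero).1 h2

theorem modeProduct_add_left (f f' g : L2R) :
    modeProduct (f + f') g = modeProduct f g + modeProduct f' g := by
  apply Lp.ext
  filter_upwards [coeFn_modeProduct (Lp.coeFn_add f f') (ae_eq_refl g),
    coeFn_modeProduct (ae_eq_refl f) (ae_eq_refl g),
    coeFn_modeProduct (ae_eq_refl f') (ae_eq_refl g),
    Lp.coeFn_add (modeProduct f g) (modeProduct f' g)] with q h1 h2 h3 h4
  rw [h1, h4, Pi.add_apply, h2, h3]
  simp only [sumDiff, Pi.add_apply]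
  ring

theorem modeProduct_add_right (f g g' : L2R) :
    modeProduct f (g + g') = modeProduct f g + modeProduct f g' := by
  apply Lp.ext
  filter_upwards [coeFn_modeProduct (ae_eq_refl f) (Lp.coeFn_add g g'),
    coeFn_modeProduct (ae_eq_refl f) (ae_eq_refl g),
    coeFn_modeProduct (ae_eq_refl f) (ae_eq_refl g'),
    Lp.coeFn_add (modeProduct f g) (modeProduct f g')] with q h1 h2 h3 h4
  rw [h1, h4, Pi.add_apply, h2, h3]
  simp only [sumDiff, Pi.add_apply]
  ring

theorem modeProduct_smul_left (c : ℂ) (f g : L2R) :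
    modeProduct (c • f) g = c • modeProduct f g := by
  apply Lp.ext
  filter_upwards [coeFn_modeProduct (Lp.coeFn_smul c f) (ae_eq_refl g),
    coeFn_modeProduct (ae_eq_refl f) (ae_eq_refl g),
    Lp.coeFn_smul c (modeProduct f g)] with q h1 h2 h4
  rw [h1, h4, Pi.smul_apply, h2]
  simp only [sumDiff, Pi.smul_apply, smul_eq_mul]
  ring

theorem modeProduct_smul_right (c : ℂ) (f g : L2R) :
    modeProduct f (c • g) = c • modeProduct f g := by
  apply Lp.ext
  filter_upwards [coeFn_modeProduct (ae_eq_refl f) (Lp.coeFn_smul c g),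
    coeFn_modeProduct (ae_eq_refl f) (ae_eq_refl g),
    Lp.coeFn_smul c (modeProduct f g)] with q h1 h2 h4
  rw [h1, h4, Pi.smul_apply, h2]
  simp only [sumDiff, Pi.smul_apply, smul_eq_mul]
  ring

/-- `modeProduct` as a bounded bilinear map; the function of `x - y` comes first. -/
def mode : L2R →L[ℂ] L2R →L[ℂ] L2R2 :=
  LinearMap.mkContinuous₂
    (LinearMap.mk₂ ℂ (fun g f => modeProduct f g)
      (fun g g' f => modeProduct_add_right f g g') (fun c g f => modeProduct_smul_right c f g)
      (fun g f f' => modeProduct_add_left f f' g) (fun c g f => modeProduct_smul_left c f g))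
    1 fun g f => by
      rw [one_mul]
      exact (norm_modeProduct f g).le

theorem mode_apply (g f : L2R) : mode g f = modeProduct f g := rfl

/-- An integrable function on a product space whose integral over every measurable rectangle
vanishes is zero almost everywhere. -/
theorem ae_eq_zero_of_setIntegral_prod {Φ : ℝ × ℝ → ℂ} (hΦ : Integrable Φ)
    (h : ∀ s t : Set ℝ, MeasurableSet s → MeasurableSet t → ∫ p in s ×ˢ t, Φ p = 0) :
    Φ =ᵐ[volume] 0 := by
  refine hΦ.ae_eq_zero_of_forall_setIntegral_eq_zero fun S hS hfin => ?_
  clear hfin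
  induction S, hS using MeasurableSpace.induction_on_inter generateFrom_prod.symm isPiSystem_prod
    with
  | empty => simp
  | basic S hS =>
    obtain ⟨s, hs, t, ht, rfl⟩ := hS
    exact h s t hs ht
  | compl S hS ih =>
    have h1 := integral_add_compl hS hΦ
    have h2 := h Set.univ Set.univ MeasurableSet.univ MeasurableSet.univ
    rw [Set.univ_prod_univ, setIntegral_univ] at h2
    rw [ih, zero_add, h2] at h1
    exact h1
  | iUnion S hd hS ih =>
    rw [integral_iUnion hS hd hΦ.integrableOn]
    simp [ih]

/-- The vectors `mode g f` span a dense subspace since rectangles generate the σ-algebra of the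
plane. -/
theorem isHilbertTensor_mode : IsHilbertTensor mode where
  inner_apply g g' f f' := inner_modeProduct f g f' g'
  dense x hx := by
    have h1 : 0 < (1 : ℂ).re := by simp
    let γ : ℝ → ℂ := gaussLp 1 0
    have hγ : ∀ᵐ u, γ u ≠ 0 := by
      filter_upwards [coeFn_gaussLp h1 0] with u hu
      rw [show γ u = _ from hu]; exact Complex.exp_ne_zero _
    -- In rotated coordinates, `x` times a Gaussian is integrable over rectangles with value zero.
    let Φ : ℝ × ℝ → ℂ := fun p => starRingEnd ℂ (γ p.1 * γ p.2) * x (rotEquiv p)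
    have hΦT : ∀ q, Φ (rotEquiv q) = starRingEnd ℂ (sumDiff √2 γ γ q) * x q := fun q => by
      simp only [Φ, rotEquiv_rotEquiv, sumDiff_eq]
    have hγL : gaussLp 1 0 =ᵐ[volume] γ := ae_eq_refl _
    have hΦ : Integrable Φ := by
      rw [← measurePreserving_rotEquiv.integrable_comp_emb
        rotEquiv.toHomeomorph.toMeasurableEquiv.measurableEmbedding]
      refine (L2.integrable_inner (𝕜 := ℂ) (modeProduct (gaussLp 1 0) (gaussLp 1 0)) x).congr ?_
      filter_upwards [coeFn_modeProduct hγL hγL] with q hq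
      rw [hq, RCLike.inner_apply, mul_comm]
      exact (hΦT q).symm
    have hzero : Φ =ᵐ[volume] 0 := by
      refine ae_eq_zero_of_setIntegral_prod hΦ fun s t hs ht => ?_
      have hs2 := (Lp.memLp (gaussLp 1 0)).indicator hs
      have ht2 := (Lp.memLp (gaussLp 1 0)).indicator ht
      have h0 := hx (ht2.toLp _) (hs2.toLp _)
      rw [mode_apply, L2.inner_def] at h0
      rw [← integral_indicator (hs.prod ht), ← h0,
        ← measurePreserving_rotEquiv.integral_comp' ((s ×ˢ t).indicator Φ)]
      refine integral_congr_ae ?_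
      filter_upwards [coeFn_modeProduct hs2.coeFn_toLp ht2.coeFn_toLp] with q hq
      rw [hq, RCLike.inner_apply, sumDiff_eq]
      change (s ×ˢ t).indicator Φ (rotEquiv q) = _
      by_cases h2 : (rotEquiv q).1 ∈ s <;> by_cases h3 : (rotEquiv q).2 ∈ t <;>
        simp [Set.indicator, h2, h3]
      rw [hΦT, sumDiff_eq, map_mul, mul_comm]
    apply Lp.ext
    filter_upwards [measurePreserving_rotEquiv.quasiMeasurePreserving.ae hzero,
      ae_comp_rotEquiv_fst hγ, ae_comp_rotEquiv_snd hγ,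
      Lp.coeFn_zero ℂ 2 (volume : Measure (ℝ × ℝ))] with q h2 h3 h4 h5
    have h6 : Φ (rotEquiv q) = 0 := h2
    rw [hΦT, sumDiff_eq] at h6
    rw [h5]
    simpa [h3, h4] using h6

/-! ### Coherent states as Gaussians -/

theorem quarterRoot_pow_two : ((2 : ℝ) ^ (1 / 4 : ℝ)) ^ 2 = √2 := by
  rw [← Real.rpow_natCast, ← Real.rpow_mul (by norm_num), Real.sqrt_eq_rpow]
  norm_num

theorem quarterRoot_pow_four : ((2 : ℝ) ^ (1 / 4 : ℝ)) ^ 4 = 2 := by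
  rw [← Real.rpow_natCast, ← Real.rpow_mul (by norm_num)]
  norm_num

/-- The scalar factor of `modeCoherent`. -/
def coherentFactor (β : ℂ) : ℂ :=
  (√((2 : ℝ) ^ (1 / 4 : ℝ)) * Real.pi ^ (-(1 / 4) : ℝ) : ℝ) *
    Complex.exp (-(‖β‖ : ℂ) ^ 2 / 2 - β ^ 2 / 2)

/-- The coherent state of an oscillator of frequency `√2`, that is, the function
`u ↦ 2^{1/8} ξ_β(2^{1/4} u)`, written as a multiple of a Gaussian. -/
def modeCoherent (β : ℂ) : L2R :=
  coherentFactor β • gaussLp ((√2 / 2 : ℝ) : ℂ) ((((2 : ℝ) ^ (1 / 4 : ℝ)) ^ 3 : ℝ) * β)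

theorem re_half_sqrt_two_pos : 0 < ((√2 / 2 : ℝ) : ℂ).re := by
  rw [Complex.ofReal_re]; positivity

theorem coherentFactor_ne_zero (β : ℂ) : coherentFactor β ≠ 0 := by
  refine mul_ne_zero ?_ (Complex.exp_ne_zero _)
  have : 0 < √((2 : ℝ) ^ (1 / 4 : ℝ)) * Real.pi ^ (-(1 / 4) : ℝ) := by
    have := Real.pi_pos
    positivity
  exact_mod_cast this.ne'

theorem coeFn_modeCoherent (β : ℂ) :
    modeCoherent β =ᵐ[volume] fun u : ℝ =>
      (√((2 : ℝ) ^ (1 / 4 : ℝ)) : ℂ) * coherent β ((2 : ℝ) ^ (1 / 4 : ℝ) * u) := by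
  set s : ℝ := (2 : ℝ) ^ (1 / 4 : ℝ) with hs
  have h2 : √2 = s ^ 2 := quarterRoot_pow_two.symm
  filter_upwards [coeFn_gaussLp re_half_sqrt_two_pos ((s ^ 3 : ℝ) * β),
    Lp.coeFn_smul (coherentFactor β) (gaussLp ((√2 / 2 : ℝ) : ℂ) ((s ^ 3 : ℝ) * β))] with u h3 h4
  rw [modeCoherent, ← hs, h4, Pi.smul_apply, h3, coherentFactor, coherent, h2, ← hs, smul_eq_mul]
  push_cast
  have e : Complex.exp (-(‖β‖ : ℂ) ^ 2 / 2 - β ^ 2 / 2) *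
      Complex.exp (-((s : ℂ) ^ 2 / 2) * u ^ 2 + s ^ 3 * β * u) =
      Complex.exp (-(‖β‖ : ℂ) ^ 2 / 2) *
        Complex.exp (-((s * u : ℂ) ^ 2 - 2 * (s : ℂ) ^ 2 * β * (s * u) + β ^ 2) / 2) := by
    rw [← Complex.exp_add, ← Complex.exp_add]
    congr 1
    ring
  linear_combination ((√s : ℂ) * ((Real.pi ^ (-(1 / 4) : ℝ) : ℝ) : ℂ)) * e

theorem twoModeCoherent_eq (α β : ℂ) :
    twoModeCoherent α β = mode (modeCoherent β) (modeCoherent α) := by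
  set s : ℝ := (2 : ℝ) ^ (1 / 4 : ℝ) with hs
  have hs0 : 0 < s := by positivity
  have h2 : √2 = s ^ 2 := quarterRoot_pow_two.symm
  apply Lp.ext
  rw [mode_apply, twoModeCoherent]
  filter_upwards [coeFn_modeProduct (coeFn_modeCoherent α) (coeFn_modeCoherent β),
    Lp.coeFn_smul s ((memLp_sumDiff (c := s) (by positivity)
      (memLp_coherent α) (memLp_coherent β)).toLp _),
    (memLp_sumDiff (c := s) (by positivity)
      (memLp_coherent α) (memLp_coherent β)).coeFn_toLp] with q h3 h4 h5
  rw [h3, h4, Pi.smul_apply, h5]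
  simp only [sumDiff, ← hs, h2]
  have e : ∀ v : ℝ, s * (v / s ^ 2) = v / s := fun v => by field_simp
  have e2 : (√s : ℂ) * (√s : ℂ) = s := by
    rw [← Complex.ofReal_mul, Real.mul_self_sqrt hs0.le]
  rw [e, e, Complex.real_smul, ← e2]
  ring

theorem inner_modeCoherent (α β : ℂ) :
    ⟪modeCoherent α, modeCoherent β⟫_ℂ =
      Complex.exp (-(‖α‖ : ℂ) ^ 2 / 2 - (‖β‖ : ℂ) ^ 2 / 2 + starRingEnd ℂ α * β) := by
  set s : ℝ := (2 : ℝ) ^ (1 / 4 : ℝ) with hs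
  have hs0 : 0 < s := by positivity
  have h2 : √2 = s ^ 2 := quarterRoot_pow_two.symm
  have h4 : (s : ℂ) ^ 4 = 2 := by exact_mod_cast quarterRoot_pow_four
  rw [modeCoherent, modeCoherent, inner_smul_left, inner_smul_right,
    inner_gaussLp (by positivity), coherentFactor, coherentFactor, map_mul, Complex.conj_ofReal,
    ← Complex.exp_conj, ← hs]
  have hpi := Real.pi_pos
  have hconst : (√s * Real.pi ^ (-(1 / 4) : ℝ)) * (√s * Real.pi ^ (-(1 / 4) : ℝ)) *
      √(Real.pi / (2 * (√2 / 2))) = 1 := by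
    have e1 : √s * √s = s := Real.mul_self_sqrt hs0.le
    have e2 : Real.pi ^ (-(1 / 4) : ℝ) * Real.pi ^ (-(1 / 4) : ℝ) = (√Real.pi)⁻¹ := by
      rw [← Real.rpow_add hpi, Real.sqrt_eq_rpow, ← Real.rpow_neg hpi.le]
      norm_num
    have e3 : √(Real.pi / (2 * (√2 / 2))) = √Real.pi / s := by
      rw [show 2 * (√2 / 2) = s ^ 2 by rw [h2]; ring, Real.sqrt_div hpi.le, Real.sqrt_sq hs0.le]
    have h0 : √Real.pi ≠ 0 := by positivity
    calc _ = (√s * √s) * (Real.pi ^ (-(1 / 4) : ℝ) * Real.pi ^ (-(1 / 4) : ℝ)) *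
        √(Real.pi / (2 * (√2 / 2))) := by ring
      _ = 1 := by rw [e1, e2, e3]; field_simp
  have hconst' : ((√s * Real.pi ^ (-(1 / 4) : ℝ) : ℝ) : ℂ) *
      ((√s * Real.pi ^ (-(1 / 4) : ℝ) : ℝ) : ℂ) * (√(Real.pi / (2 * (√2 / 2))) : ℂ) = 1 := by
    exact_mod_cast hconst
  have hexp : Complex.exp (starRingEnd ℂ (-(‖α‖ : ℂ) ^ 2 / 2 - α ^ 2 / 2)) *
      Complex.exp (-(‖β‖ : ℂ) ^ 2 / 2 - β ^ 2 / 2) *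
      Complex.exp ((starRingEnd ℂ ((s ^ 3 : ℝ) * α) + (s ^ 3 : ℝ) * β) ^ 2 /
        (8 * ((√2 / 2 : ℝ) : ℂ))) =
      Complex.exp (-(‖α‖ : ℂ) ^ 2 / 2 - (‖β‖ : ℂ) ^ 2 / 2 + starRingEnd ℂ α * β) := by
    rw [← Complex.exp_add, ← Complex.exp_add]
    congr 1
    rw [h2]
    have hsc : (s : ℂ) ≠ 0 := by exact_mod_cast hs0.ne'
    simp only [map_sub, map_mul, map_div₀, map_neg, map_pow, Complex.conj_ofReal,
      Complex.conj_ofNat]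
    push_cast
    have e : ((s : ℂ) ^ 3 * starRingEnd ℂ α + (s : ℂ) ^ 3 * β) ^ 2 / (8 * ((s : ℂ) ^ 2 / 2)) =
        (s : ℂ) ^ 4 * (starRingEnd ℂ α + β) ^ 2 / 4 := by
      field_simp; ring
    rw [e, h4]
    ring
  push_cast at hconst' hexp ⊢
  rw [← hexp]
  linear_combination (Complex.exp (starRingEnd ℂ (-(‖α‖ : ℂ) ^ 2 / 2 - α ^ 2 / 2)) *
      Complex.exp (-(‖β‖ : ℂ) ^ 2 / 2 - β ^ 2 / 2) *
      Complex.exp ((starRingEnd ℂ ((s : ℂ) ^ 3 * α) + (s : ℂ) ^ 3 * β) ^ 2 /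
        (8 * ((√2 : ℂ) / 2)))) * hconst'

theorem norm_modeCoherent (β : ℂ) : ‖modeCoherent β‖ = 1 := by
  have h := inner_modeCoherent β β
  rw [Complex.conj_mul', inner_self_eq_norm_sq_to_K,
    show -(‖β‖ : ℂ) ^ 2 / 2 - (‖β‖ : ℂ) ^ 2 / 2 + (‖β‖ : ℂ) ^ 2 = 0 by ring, Complex.exp_zero] at h
  have h1 : ‖modeCoherent β‖ ^ 2 = 1 := by
    apply Complex.ofReal_injective
    rw [Complex.ofReal_pow, Complex.ofReal_one]
    exact h
  exact (pow_eq_one_iff_of_nonneg (norm_nonneg _) two_ne_zero).1 h1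

theorem continuous_modeCoherent : Continuous modeCoherent := by
  have h : Continuous coherentFactor := by
    unfold coherentFactor
    fun_prop
  exact h.smul (differentiable_gaussLp re_half_sqrt_two_pos _).continuous

theorem topologicalClosure_span_modeCoherent :
    (Submodule.span ℂ (Set.range modeCoherent)).topologicalClosure = ⊤ := by
  have hc : ((((2 : ℝ) ^ (1 / 4 : ℝ)) ^ 3 : ℝ) : ℂ) ≠ 0 := by
    have : (0 : ℝ) < ((2 : ℝ) ^ (1 / 4 : ℝ)) ^ 3 := by positivity
    exact_mod_cast this.ne'
  rw [eq_top_iff, ← topologicalClosure_span_gaussLp re_half_sqrt_two_pos hc]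
  refine Submodule.topologicalClosure_mono (Submodule.span_le.2 ?_)
  rintro _ ⟨z, rfl⟩
  have h : modeCoherent z ∈ Submodule.span ℂ (Set.range modeCoherent) :=
    Submodule.subset_span ⟨z, rfl⟩
  exact (Submodule.smul_mem_iff _ (coherentFactor_ne_zero z)).1 h

/-! ### The resolution of the identity -/

/-- The integral of `exp (w̄ α + ᾱ z - |α|²)` over the plane factors into two Gaussian integrals. -/
theorem integral_exp_coherent (w z : ℂ) :
    Integrable (fun α : ℂ =>
      Complex.exp (w * α + starRingEnd ℂ α * z - (‖α‖ : ℂ) ^ 2)) ∧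
    ∫ α : ℂ, Complex.exp (w * α + starRingEnd ℂ α * z - (‖α‖ : ℂ) ^ 2) =
      Real.pi * Complex.exp (w * z) := by
  let p : ℝ → ℂ := fun x => Complex.exp (-1 * x ^ 2 + (w + z) * x + 0)
  let q : ℝ → ℂ := fun y => Complex.exp (-1 * y ^ 2 + Complex.I * (w - z) * y + 0)
  have hneg : (-1 : ℂ).re < 0 := by simp
  have he : (fun α : ℂ => Complex.exp (w * α + starRingEnd ℂ α * z - (‖α‖ : ℂ) ^ 2)) =
      (fun r : ℝ × ℝ => p r.1 * q r.2) ∘ Complex.measurableEquivRealProd := by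
    funext α
    simp only [Function.comp_apply, Complex.measurableEquivRealProd_apply, p, q]
    rw [← Complex.exp_add]
    congr 1
    have hn : (‖α‖ : ℂ) ^ 2 = (α.re : ℂ) ^ 2 + (α.im : ℂ) ^ 2 := by
      rw [← Complex.ofReal_pow, Complex.sq_norm, Complex.normSq_apply]
      push_cast; ring
    have hα : α = α.re + α.im * Complex.I := (Complex.re_add_im α).symm
    have hα' : starRingEnd ℂ α = α.re - α.im * Complex.I :=
      Complex.ext (by simp) (by simp)
    rw [hn, hα']
    linear_combination w * hα
  have hp : Integrable p := integrable_cexp_quadratic' hneg _ _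
  have hq : Integrable q := integrable_cexp_quadratic' hneg _ _
  have hmp := Complex.volume_preserving_equiv_real_prod
  constructor
  · rw [he, hmp.integrable_comp_emb Complex.measurableEquivRealProd.measurableEmbedding,
      Measure.volume_eq_prod]
    exact hp.mul_prod hq
  · rw [he]
    have h1 := hmp.integral_comp' (fun r : ℝ × ℝ => p r.1 * q r.2)
    refine h1.trans ?_
    rw [Measure.volume_eq_prod, integral_prod_mul p q, integral_cexp_quadratic hneg,
      integral_cexp_quadratic hneg]
    have hpi : (Real.pi : ℂ) ^ (1 / 2 : ℂ) * (Real.pi : ℂ) ^ (1 / 2 : ℂ) = Real.pi := by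
      rw [← Complex.cpow_add _ _ (by exact_mod_cast Real.pi_ne_zero)]
      norm_num
    have he2 : Complex.exp (0 - (w + z) ^ 2 / (4 * -1)) *
        Complex.exp (0 - (Complex.I * (w - z)) ^ 2 / (4 * -1)) = Complex.exp (w * z) := by
      rw [← Complex.exp_add, mul_pow, Complex.I_sq]
      congr 1
      ring
    rw [neg_neg, div_one, ← he2]
    linear_combination (Complex.exp (0 - (w + z) ^ 2 / (4 * -1)) *
        Complex.exp (0 - (Complex.I * (w - z)) ^ 2 / (4 * -1))) * hpi

/-- The resolution of the identity by coherent states, tested on `f` and `g`. -/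
def ResolvesAt (f g : L2R) : Prop :=
  Integrable (fun α : ℂ => ⟪f, modeCoherent α⟫_ℂ * ⟪modeCoherent α, g⟫_ℂ) ∧
    ∫ α : ℂ, ⟪f, modeCoherent α⟫_ℂ * ⟪modeCoherent α, g⟫_ℂ = Real.pi * ⟪f, g⟫_ℂ

/-- On coherent states the resolution of the identity is an explicit Gaussian integral. -/
theorem resolvesAt_modeCoherent (w z : ℂ) : ResolvesAt (modeCoherent w) (modeCoherent z) := by
  have he : (fun α : ℂ => ⟪modeCoherent w, modeCoherent α⟫_ℂ * ⟪modeCoherent α, modeCoherent z⟫_ℂ) =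
      fun α : ℂ => Complex.exp (-(‖w‖ : ℂ) ^ 2 / 2 - (‖z‖ : ℂ) ^ 2 / 2) *
        Complex.exp (starRingEnd ℂ w * α + starRingEnd ℂ α * z - (‖α‖ : ℂ) ^ 2) := by
    funext α
    rw [inner_modeCoherent, inner_modeCoherent, ← Complex.exp_add, ← Complex.exp_add]
    congr 1
    ring
  obtain ⟨h1, h2⟩ := integral_exp_coherent (starRingEnd ℂ w) z
  rw [ResolvesAt, he]
  refine ⟨h1.const_mul _, ?_⟩
  rw [integral_const_mul, h2, inner_modeCoherent, Complex.exp_add]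
  ring

theorem ResolvesAt.of_mem_span {f g : L2R}
    (hf : f ∈ Submodule.span ℂ (Set.range modeCoherent))
    (hg : g ∈ Submodule.span ℂ (Set.range modeCoherent)) : ResolvesAt f g := by
  have hright : ∀ w, ResolvesAt (modeCoherent w) g := by
    intro w
    induction hg using Submodule.span_induction with
    | mem x hx => obtain ⟨z, rfl⟩ := hx; exact resolvesAt_modeCoherent w z
    | zero => simp [ResolvesAt]
    | add x y _ _ hx hy =>
      simp only [ResolvesAt, inner_add_right, mul_add]
      exact ⟨hx.1.add hy.1, by rw [integral_add hx.1 hy.1, hx.2, hy.2]⟩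
    | smul c x _ hx =>
      simp only [ResolvesAt, inner_smul_right, mul_left_comm _ c]
      exact ⟨hx.1.const_mul c, by rw [integral_const_mul, hx.2]⟩
  induction hf using Submodule.span_induction with
  | mem x hx => obtain ⟨z, rfl⟩ := hx; exact hright z
  | zero => simp [ResolvesAt]
  | add x y _ _ hx hy =>
    simp only [ResolvesAt, inner_add_left, add_mul, mul_add]
    exact ⟨hx.1.add hy.1, by rw [integral_add hx.1 hy.1, hx.2, hy.2]⟩
  | smul c x _ hx =>
    simp only [ResolvesAt, inner_smul_left, mul_assoc, mul_left_comm _ (starRingEnd ℂ c)]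
    exact ⟨hx.1.const_mul _, by rw [integral_const_mul, hx.2]⟩

theorem continuous_inner_modeCoherent (f : L2R) : Continuous fun α => ⟪modeCoherent α, f⟫_ℂ :=
  continuous_modeCoherent.inner continuous_const

theorem lintegral_inner_modeCoherent_of_mem_span {f : L2R}
    (hf : f ∈ Submodule.span ℂ (Set.range modeCoherent)) :
    ∫⁻ α : ℂ, ENNReal.ofReal (‖⟪modeCoherent α, f⟫_ℂ‖ ^ 2) =
      ENNReal.ofReal (Real.pi * ‖f‖ ^ 2) := by
  obtain ⟨h1, h2⟩ := ResolvesAt.of_mem_span hf hf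
  have he : ∀ α : ℂ, ⟪f, modeCoherent α⟫_ℂ * ⟪modeCoherent α, f⟫_ℂ =
      ((‖⟪modeCoherent α, f⟫_ℂ‖ ^ 2 : ℝ) : ℂ) := by
    intro α
    rw [← inner_conj_symm f (modeCoherent α), Complex.conj_mul']
    push_cast; rfl
  simp only [he] at h1 h2
  have h1' : Integrable fun α : ℂ => ‖⟪modeCoherent α, f⟫_ℂ‖ ^ 2 := by
    refine h1.re.congr (Eventually.of_forall fun α => ?_)
    exact Complex.ofReal_re _
  rw [← ofReal_integral_eq_lintegral_ofReal h1' (Eventually.of_forall fun _ => by positivity)]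
  congr 1
  rw [integral_complex_ofReal, inner_self_eq_norm_sq_to_K] at h2
  apply Complex.ofReal_injective
  rw [h2, Complex.ofReal_mul, Complex.ofReal_pow]
  rfl

/-- The coherent state transform does not increase the norm (up to the factor `π`), by density of
the span of coherent states and Fatou's lemma. -/
theorem lintegral_inner_modeCoherent_le (f : L2R) :
    ∫⁻ α : ℂ, ENNReal.ofReal (‖⟪modeCoherent α, f⟫_ℂ‖ ^ 2) ≤
      ENNReal.ofReal (Real.pi * ‖f‖ ^ 2) := by
  have hf : f ∈ closure (Submodule.span ℂ (Set.range modeCoherent) : Set L2R) := by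
    rw [← Submodule.topologicalClosure_coe, topologicalClosure_span_modeCoherent]; trivial
  obtain ⟨u, hu, hlim⟩ := mem_closure_iff_seq_limit.1 hf
  have hpt : ∀ α : ℂ, ENNReal.ofReal (‖⟪modeCoherent α, f⟫_ℂ‖ ^ 2) =
      liminf (fun n => ENNReal.ofReal (‖⟪modeCoherent α, u n⟫_ℂ‖ ^ 2)) atTop := by
    intro α
    refine (Tendsto.liminf_eq ?_).symm
    exact ENNReal.tendsto_ofReal ((tendsto_const_nhds.inner hlim).norm.pow 2)
  have hR : Tendsto (fun n => ENNReal.ofReal (Real.pi * ‖u n‖ ^ 2)) atTop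
      (𝓝 (ENNReal.ofReal (Real.pi * ‖f‖ ^ 2))) :=
    ENNReal.tendsto_ofReal ((hlim.norm.pow 2).const_mul _)
  simp only [hpt]
  refine (lintegral_liminf_le fun n => ?_).trans ?_
  · exact ((continuous_inner_modeCoherent (u n)).norm.pow 2).measurable.ennreal_ofReal
  · simp only [fun n => lintegral_inner_modeCoherent_of_mem_span (hu n)]
    exact hR.liminf_eq.le

theorem memLp_inner_modeCoherent (f : L2R) :
    MemLp (fun α => ⟪modeCoherent α, f⟫_ℂ) 2 (volume : Measure ℂ) := by
  rw [memLp_two_iff_integrable_sq_norm (continuous_inner_modeCoherent f).aestronglyMeasurable]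
  refine ⟨((continuous_inner_modeCoherent f).norm.pow 2).aestronglyMeasurable, ?_⟩
  rw [hasFiniteIntegral_iff_ofReal (Eventually.of_forall fun _ => by positivity)]
  exact (lintegral_inner_modeCoherent_le f).trans_lt ENNReal.ofReal_lt_top

/-- The coherent state transform `f ↦ (α ↦ ⟨ξ_α, f⟩)` from `L²(ℝ)` to `L²(ℂ)`. -/
def coherentTransform : L2R →L[ℂ] Lp ℂ 2 (volume : Measure ℂ) :=
  LinearMap.mkContinuous
    { toFun := fun f => (memLp_inner_modeCoherent f).toLp _
      map_add' := fun f g => by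
        rw [← MemLp.toLp_add]
        refine MemLp.toLp_congr _ _ (Eventually.of_forall fun α => ?_)
        simp [inner_add_right]
      map_smul' := fun c f => by
        rw [RingHom.id_apply, ← MemLp.toLp_const_smul]
        refine MemLp.toLp_congr _ _ (Eventually.of_forall fun α => ?_)
        simp [inner_smul_right] }
    √Real.pi fun f => by
      have h1 : Integrable fun α => ‖⟪modeCoherent α, f⟫_ℂ‖ ^ 2 :=
        (memLp_two_iff_integrable_sq_norm
          (continuous_inner_modeCoherent f).aestronglyMeasurable).1 (memLp_inner_modeCoherent f)
      have h2 : ‖(memLp_inner_modeCoherent f).toLp _‖ ^ 2 =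
          ∫ α, ‖⟪modeCoherent α, f⟫_ℂ‖ ^ 2 := by
        rw [← inner_self_eq_norm_sq (𝕜 := ℂ), L2.inner_def, ← integral_re]
        · refine integral_congr_ae ?_
          filter_upwards [(memLp_inner_modeCoherent f).coeFn_toLp] with α hα
          rw [hα, inner_self_eq_norm_sq (𝕜 := ℂ)]
        · exact L2.integrable_inner _ _
      have h3 : ∫ α, ‖⟪modeCoherent α, f⟫_ℂ‖ ^ 2 ≤ Real.pi * ‖f‖ ^ 2 := by
        have := lintegral_inner_modeCoherent_le f
        rw [← ofReal_integral_eq_lintegral_ofReal h1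
          (Eventually.of_forall fun _ => by positivity)] at this
        exact (ENNReal.ofReal_le_ofReal_iff (by positivity)).1 this
      refine abs_le_of_sq_le_sq' ?_ (by positivity) |>.2
      rw [mul_pow, Real.sq_sqrt Real.pi_pos.le]
      exact h2.trans_le h3

theorem coeFn_coherentTransform (f : L2R) :
    coherentTransform f =ᵐ[volume] fun α => ⟪modeCoherent α, f⟫_ℂ :=
  (memLp_inner_modeCoherent f).coeFn_toLp

theorem inner_coherentTransform_eq_integral (f g : L2R) :
    ⟪coherentTransform f, coherentTransform g⟫_ℂ =
      ∫ α : ℂ, ⟪f, modeCoherent α⟫_ℂ * ⟪modeCoherent α, g⟫_ℂ := by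
  rw [L2.inner_def]
  refine integral_congr_ae ?_
  filter_upwards [coeFn_coherentTransform f, coeFn_coherentTransform g] with α h1 h2
  rw [h1, h2, RCLike.inner_apply, inner_conj_symm, mul_comm]

/-- The resolution of the identity `π⁻¹ ∫ |ξ_α⟩⟨ξ_α| d²α = 1` in the weak sense. -/
theorem resolvesAt (f g : L2R) : ResolvesAt f g := by
  have hint : Integrable fun α : ℂ => ⟪f, modeCoherent α⟫_ℂ * ⟪modeCoherent α, g⟫_ℂ := by
    refine (L2.integrable_inner (𝕜 := ℂ) (coherentTransform f) (coherentTransform g)).congr ?_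
    filter_upwards [coeFn_coherentTransform f, coeFn_coherentTransform g] with α h1 h2
    rw [h1, h2, RCLike.inner_apply, inner_conj_symm, mul_comm]
  refine ⟨hint, ?_⟩
  rw [← inner_coherentTransform_eq_integral]
  have hd : Dense (Submodule.span ℂ (Set.range modeCoherent) : Set L2R) :=
    Submodule.dense_iff_topologicalClosure_eq_top.2 topologicalClosure_span_modeCoherent
  have hfun : (fun p : L2R × L2R => ⟪coherentTransform p.1, coherentTransform p.2⟫_ℂ) =
      fun p => Real.pi * ⟪p.1, p.2⟫_ℂ := by
    refine Continuous.ext_on (hd.prod hd) ?_ ?_ ?_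
    · exact (coherentTransform.continuous.comp continuous_fst).inner
        (coherentTransform.continuous.comp continuous_snd)
    · exact continuous_const.mul (continuous_fst.inner continuous_snd)
    · rintro ⟨f, g⟩ ⟨hf, hg⟩
      simp only
      rw [inner_coherentTransform_eq_integral]
      exact (ResolvesAt.of_mem_span hf hg).2
  exact congrFun hfun (f, g)

/-- The weak integral `Q_β` exists and equals `1 ⊗ |ξ_β⟩⟨ξ_β|`. -/
theorem isCoherentIntegral_iff {β : ℂ} {Q : L2R2 →L[ℂ] L2R2} :
    IsCoherentIntegral β Q ↔ Q = ampRankOne mode (modeCoherent β) (modeCoherent β) := by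
  have hQ : IsCoherentIntegral β (ampRankOne mode (modeCoherent β) (modeCoherent β)) := by
    intro F G
    have h1 : ∀ α, ⟪F, twoModeCoherent α β⟫_ℂ =
        ⟪adjoint (mode (modeCoherent β)) F, modeCoherent α⟫_ℂ := fun α => by
      rw [twoModeCoherent_eq, adjoint_inner_left]
    have h2 : ∀ α, ⟪twoModeCoherent α β, G⟫_ℂ =
        ⟪modeCoherent α, adjoint (mode (modeCoherent β)) G⟫_ℂ := fun α => by
      rw [twoModeCoherent_eq, adjoint_inner_right]
    simp only [h1, h2]
    obtain ⟨h3, h4⟩ := resolvesAt (adjoint (mode (modeCoherent β)) F)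
      (adjoint (mode (modeCoherent β)) G)
    refine ⟨h3, ?_⟩
    rw [h4, ampRankOne_apply, ← mul_assoc,
      inv_mul_cancel₀ (by exact_mod_cast Real.pi_ne_zero), one_mul, adjoint_inner_left]
  refine ⟨fun h => ?_, fun h => h ▸ hQ⟩
  refine ContinuousLinearMap.ext fun G => ext_inner_left ℂ fun F => ?_
  rw [(h F G).2, (hQ F G).2]

/-! ### Uniqueness for unitary evolutions -/

section UnitaryGroup

variable {K : Type*} [NormedAddCommGroup K] [InnerProductSpace ℂ K]

/-- The product rule for `h ↦ A h (x h)` at `0`, with isometries `A h` that depend on `h` only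
strongly continuously. -/
theorem hasDerivAt_isometry_apply {A : ℝ → K →L[ℂ] K} (hA : ∀ h y, ‖A h y‖ = ‖y‖)
    (hA0 : ∀ y, A 0 y = y) (hAc : ∀ y, Continuous fun h => A h y) {x : ℝ → K} {x' y' : K}
    (hx : HasDerivAt x x' 0) (hAx : HasDerivAt (fun h => A h (x 0)) y' 0) :
    HasDerivAt (fun h => A h (x h)) (x' + y') 0 := by
  rw [hasDerivAt_iff_isLittleO_nhds_zero] at hx hAx ⊢
  simp only [zero_add] at hx hAx ⊢
  have h1 : (fun h => A h (x h - x 0 - h • x')) =o[𝓝 0] fun h : ℝ => h :=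
    (Asymptotics.isBigO_of_le _ fun h => (hA h _).le).trans_isLittleO hx
  have h2 : (fun h : ℝ => h • (A h x' - x')) =o[𝓝 0] fun h : ℝ => h := by
    have hlim : Tendsto (fun h => A h x' - x') (𝓝 0) (𝓝 0) := by
      have := ((hAc x').tendsto 0).sub_const x'
      rwa [hA0, sub_self] at this
    have := (Asymptotics.isBigO_refl (fun h : ℝ => h) (𝓝 0)).smul_isLittleO
      ((Asymptotics.isLittleO_one_iff ℝ).2 hlim)
    simpa using this
  refine ((h1.add h2).add hAx).congr_left fun h => ?_
  rw [hA0, map_sub, map_sub, map_smul_of_tower]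
  module

variable [CompleteSpace K] {U : ℝ → unitary (K →L[ℂ] K)}

theorem unitaryGroup_zero (hadd : ∀ s t, U (s + t) = U s * U t) : U 0 = 1 := by
  have h := hadd 0 0
  rw [add_zero] at h
  exact (mul_eq_left.1 h.symm)

theorem unitaryGroup_neg (hadd : ∀ s t, U (s + t) = U s * U t) (t : ℝ) : U (-t) = star (U t) := by
  have h := hadd (-t) t
  rw [neg_add_cancel, unitaryGroup_zero hadd] at h
  exact eq_inv_of_mul_eq_one_left h.symm

/-- A differentiable curve whose derivative at each time is the one prescribed by a strongly
continuous unitary group is an orbit of the group. -/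
theorem unitaryGroup_apply_eq (hadd : ∀ s t, U (s + t) = U s * U t)
    (hcont : ∀ x, Continuous fun t => (U t : K →L[ℂ] K) x) {ψ ψ' : ℝ → K}
    (hψ : ∀ t, HasDerivAt ψ (ψ' t) t)
    (hU : ∀ t, HasDerivAt (fun s => (U s : K →L[ℂ] K) (ψ t)) (ψ' t) 0) (t : ℝ) :
    (U t : K →L[ℂ] K) (ψ 0) = ψ t := by
  have happ : ∀ s t x, (U (s + t) : K →L[ℂ] K) x = (U s : K →L[ℂ] K) ((U t : K →L[ℂ] K) x) := by
    intro s t x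
    rw [hadd]; rfl
  have hz : ∀ x, (U 0 : K →L[ℂ] K) x = x := fun x => by rw [unitaryGroup_zero hadd]; rfl
  have hderiv : ∀ t, HasDerivAt (fun s => (U (-s) : K →L[ℂ] K) (ψ s)) 0 t := by
    intro t
    have h1 : HasDerivAt (fun h => (U (-h) : K →L[ℂ] K) (ψ (t + h))) (ψ' t + -ψ' t) 0 := by
      refine hasDerivAt_isometry_apply (A := fun h => (U (-h) : K →L[ℂ] K))
        (x := fun h => ψ (t + h)) (fun h y => Unitary.norm_map _ _) ?_ ?_ ?_ ?_
      · intro y; simp [hz]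
      · intro y; exact (hcont y).comp continuous_neg
      · refine HasDerivAt.comp_const_add t 0 ?_
        rw [add_zero]; exact hψ t
      · have h2 : HasDerivAt (fun s => (U s : K →L[ℂ] K) (ψ t)) (ψ' t) (-0) := by
          rw [neg_zero]; exact hU t
        have h3 := h2.scomp (0 : ℝ) (hasDerivAt_neg (0 : ℝ))
        simpa [Function.comp_def] using h3
    rw [add_neg_cancel] at h1
    let L : K →L[ℝ] K := (U (-t) : K →L[ℂ] K).restrictScalars ℝ
    have h4 : HasDerivAt (fun h => (U (-t) : K →L[ℂ] K) ((U (-h) : K →L[ℂ] K) (ψ (t + h))))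
        ((U (-t) : K →L[ℂ] K) 0) 0 :=
      L.hasFDerivAt.comp_hasDerivAt 0 h1
    rw [map_zero] at h4
    have h5 : (fun s => (U (-s) : K →L[ℂ] K) (ψ s)) = fun s =>
        (fun h => (U (-t) : K →L[ℂ] K) ((U (-h) : K →L[ℂ] K) (ψ (t + h)))) (s - t) := by
      funext s
      simp only
      rw [← happ]
      rw [show -t + -(s - t) = -s by ring, show t + (s - t) = s by ring]
    rw [h5]
    refine HasDerivAt.comp_sub_const
      (f := fun h => (U (-t) : K →L[ℂ] K) ((U (-h) : K →L[ℂ] K) (ψ (t + h)))) t t ?_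
    rw [sub_self]
    exact h4
  have hconst := is_const_of_deriv_eq_zero (𝕜 := ℝ)
    (f := fun s => (U (-s) : K →L[ℂ] K) (ψ s)) (fun s => (hderiv s).differentiableAt)
    (fun s => (hderiv s).deriv) 0 t
  simp only [neg_zero, hz] at hconst
  rw [hconst, ← happ, add_neg_cancel, hz]

end UnitaryGroup

/-! ### Products of Schwartz functions -/

theorem norm_iteratedFDeriv_comp_fst_le (f : 𝓢(ℝ, ℂ)) (i : ℕ) (p : ℝ × ℝ) :
    ‖iteratedFDeriv ℝ i (fun p : ℝ × ℝ => f p.1) p‖ ≤ ‖iteratedFDeriv ℝ i f p.1‖ := by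
  have h := (ContinuousLinearMap.fst ℝ ℝ ℝ).iteratedFDeriv_comp_right (f.smooth i) p le_rfl
  rw [show (fun p : ℝ × ℝ => f p.1) = f ∘ ContinuousLinearMap.fst ℝ ℝ ℝ from rfl, h]
  refine (ContinuousMultilinearMap.norm_compContinuousLinearMap_le _ _).trans ?_
  refine mul_le_of_le_one_right (norm_nonneg _) ?_
  exact Finset.prod_le_one (fun _ _ => norm_nonneg _) fun _ _ => norm_fst_le ℝ ℝ ℝ

theorem norm_iteratedFDeriv_comp_snd_le (f : 𝓢(ℝ, ℂ)) (i : ℕ) (p : ℝ × ℝ) :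
    ‖iteratedFDeriv ℝ i (fun p : ℝ × ℝ => f p.2) p‖ ≤ ‖iteratedFDeriv ℝ i f p.2‖ := by
  have h := (ContinuousLinearMap.snd ℝ ℝ ℝ).iteratedFDeriv_comp_right (f.smooth i) p le_rfl
  rw [show (fun p : ℝ × ℝ => f p.2) = f ∘ ContinuousLinearMap.snd ℝ ℝ ℝ from rfl, h]
  refine (ContinuousMultilinearMap.norm_compContinuousLinearMap_le _ _).trans ?_
  refine mul_le_of_le_one_right (norm_nonneg _) ?_
  exact Finset.prod_le_one (fun _ _ => norm_nonneg _) fun _ _ => norm_snd_le ℝ ℝ ℝ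

/-- The Schwartz function `(u, v) ↦ f u * g v`. -/
def tensorSchwartz (f g : 𝓢(ℝ, ℂ)) : 𝓢(ℝ × ℝ, ℂ) where
  toFun p := f p.1 * g p.2
  smooth' := ((f.smooth ⊤).comp contDiff_fst).mul ((g.smooth ⊤).comp contDiff_snd)
  decay' k n := by
    let S : ℕ → ℕ → 𝓢(ℝ, ℂ) → ℝ := fun k n f => SchwartzMap.seminorm ℝ k n f
    refine ⟨∑ i ∈ Finset.range (n + 1), (n.choose i : ℝ) *
      (S k i f * S 0 (n - i) g + S 0 i f * S k (n - i) g), fun p => ?_⟩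
    have hf : ContDiff ℝ n fun p : ℝ × ℝ => f p.1 := (f.smooth n).comp contDiff_fst
    have hg : ContDiff ℝ n fun p : ℝ × ℝ => g p.2 := (g.smooth n).comp contDiff_snd
    refine (mul_le_mul_of_nonneg_left (norm_iteratedFDeriv_mul_le hf hg p le_rfl)
      (by positivity)).trans ?_
    rw [Finset.mul_sum]
    refine Finset.sum_le_sum fun i _ => ?_
    have hp : ‖p‖ ^ k ≤ ‖p.1‖ ^ k + ‖p.2‖ ^ k := by
      rw [Prod.norm_def]
      rcases max_cases ‖p.1‖ ‖p.2‖ with ⟨h, _⟩ | ⟨h, _⟩ <;> rw [h]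
      · exact le_add_of_nonneg_right (by positivity)
      · exact le_add_of_nonneg_left (by positivity)
    have e1 := SchwartzMap.le_seminorm ℝ k i f p.1
    have e2 := SchwartzMap.le_seminorm ℝ 0 i f p.1
    have e3 := SchwartzMap.le_seminorm ℝ k (n - i) g p.2
    have e4 := SchwartzMap.le_seminorm ℝ 0 (n - i) g p.2
    rw [pow_zero, one_mul] at e2 e4
    calc ‖p‖ ^ k * ((n.choose i : ℝ) * ‖iteratedFDeriv ℝ i (fun p : ℝ × ℝ => f p.1) p‖ *
          ‖iteratedFDeriv ℝ (n - i) (fun p : ℝ × ℝ => g p.2) p‖)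
        ≤ (‖p.1‖ ^ k + ‖p.2‖ ^ k) * ((n.choose i : ℝ) * ‖iteratedFDeriv ℝ i f p.1‖ *
          ‖iteratedFDeriv ℝ (n - i) g p.2‖) := by
          gcongr
          · exact norm_iteratedFDeriv_comp_fst_le f i p
          · exact norm_iteratedFDeriv_comp_snd_le g (n - i) p
      _ = (n.choose i : ℝ) * ((‖p.1‖ ^ k * ‖iteratedFDeriv ℝ i f p.1‖) *
          ‖iteratedFDeriv ℝ (n - i) g p.2‖ + ‖iteratedFDeriv ℝ i f p.1‖ *
          (‖p.2‖ ^ k * ‖iteratedFDeriv ℝ (n - i) g p.2‖)) := by ring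
      _ ≤ _ := by
        have n1 : 0 ≤ S k i f := apply_nonneg _ _
        have n2 : 0 ≤ S 0 i f := apply_nonneg _ _
        gcongr

/-- The Schwartz function `(x, y) ↦ f ((x + y) / √2) * g ((x - y) / √2)`. -/
def modeSchwartz (f g : 𝓢(ℝ, ℂ)) : 𝓢(ℝ × ℝ, ℂ) :=
  SchwartzMap.compCLMOfContinuousLinearEquiv ℂ rotEquiv (tensorSchwartz f g)

theorem modeSchwartz_apply (f g : 𝓢(ℝ, ℂ)) (p : ℝ × ℝ) :
    modeSchwartz f g p = f ((p.1 + p.2) / √2) * g ((p.1 - p.2) / √2) := rfl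

theorem toLp_modeSchwartz (f g : 𝓢(ℝ, ℂ)) :
    (modeSchwartz f g).toLp 2 volume = mode (g.toLp 2 volume) (f.toLp 2 volume) := by
  apply Lp.ext
  rw [mode_apply]
  filter_upwards [(modeSchwartz f g).coeFn_toLp 2 volume,
    coeFn_modeProduct (f.coeFn_toLp 2 volume) (g.coeFn_toLp 2 volume)] with p h1 h2
  rw [h1, h2]
  rfl

/-! ### The Hamiltonian in normal coordinates -/

theorem hasDerivAt_derivCLM (f : 𝓢(ℝ, ℂ)) (u : ℝ) :
    HasDerivAt f (SchwartzMap.derivCLM ℝ ℂ f u) u := by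
  rw [SchwartzMap.derivCLM_apply]
  exact f.differentiableAt.hasDerivAt

theorem lineDeriv_fst_modeSchwartz (f g : 𝓢(ℝ, ℂ)) :
    ∂_{((1, 0) : ℝ × ℝ)} (modeSchwartz f g) =
      (1 / √2 : ℝ) • (modeSchwartz (SchwartzMap.derivCLM ℝ ℂ f) g +
        modeSchwartz f (SchwartzMap.derivCLM ℝ ℂ g)) := by
  ext p
  rw [SchwartzMap.lineDerivOp_apply]
  refine HasLineDerivAt.lineDeriv ?_
  have h1 : HasDerivAt (fun t : ℝ => (p.1 + t + p.2) / √2) (1 / √2) 0 :=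
    (((hasDerivAt_id (0 : ℝ)).const_add p.1).add_const p.2).div_const _
  have h2 : HasDerivAt (fun t : ℝ => (p.1 + t - p.2) / √2) (1 / √2) 0 :=
    (((hasDerivAt_id (0 : ℝ)).const_add p.1).sub_const p.2).div_const _
  have h3 := (hasDerivAt_derivCLM f ((p.1 + 0 + p.2) / √2)).scomp (0 : ℝ) h1
  have h4 := (hasDerivAt_derivCLM g ((p.1 + 0 - p.2) / √2)).scomp (0 : ℝ) h2
  have h5 := h3.mul h4
  simp only [add_zero, Function.comp_apply] at h5
  have h6 : HasDerivAt (fun t : ℝ => modeSchwartz f g (p + t • ((1, 0) : ℝ × ℝ))) _ 0 :=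
    h5.congr_of_eventuallyEq (Eventually.of_forall fun t => by simp [modeSchwartz_apply])
  refine HasDerivAt.congr_deriv h6 ?_
  simp only [smul_apply, add_apply, modeSchwartz_apply,
    Complex.real_smul]
  ring

theorem lineDeriv_snd_modeSchwartz (f g : 𝓢(ℝ, ℂ)) :
    ∂_{((0, 1) : ℝ × ℝ)} (modeSchwartz f g) =
      (1 / √2 : ℝ) • (modeSchwartz (SchwartzMap.derivCLM ℝ ℂ f) g -
        modeSchwartz f (SchwartzMap.derivCLM ℝ ℂ g)) := by
  ext p
  rw [SchwartzMap.lineDerivOp_apply]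
  refine HasLineDerivAt.lineDeriv ?_
  have h1 : HasDerivAt (fun t : ℝ => (p.1 + (p.2 + t)) / √2) (1 / √2) 0 :=
    (((hasDerivAt_id (0 : ℝ)).const_add p.2).const_add p.1).div_const _
  have h2 : HasDerivAt (fun t : ℝ => (p.1 - (p.2 + t)) / √2) (-1 / √2) 0 :=
    (((hasDerivAt_id (0 : ℝ)).const_add p.2).const_sub p.1).div_const _
  have h3 := (hasDerivAt_derivCLM f ((p.1 + (p.2 + 0)) / √2)).scomp (0 : ℝ) h1
  have h4 := (hasDerivAt_derivCLM g ((p.1 - (p.2 + 0)) / √2)).scomp (0 : ℝ) h2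
  have h5 := h3.mul h4
  simp only [add_zero, Function.comp_apply] at h5
  have h6 : HasDerivAt (fun t : ℝ => modeSchwartz f g (p + t • ((0, 1) : ℝ × ℝ))) _ 0 :=
    h5.congr_of_eventuallyEq (Eventually.of_forall fun t => by simp [modeSchwartz_apply])
  refine HasDerivAt.congr_deriv h6 ?_
  simp only [smul_apply, sub_apply, modeSchwartz_apply,
    Complex.real_smul]
  push_cast
  ring

/-- In the coordinates `u = (x + y) / √2` and `v = (x - y) / √2` the Hamiltonian is
`-½ ∂²/∂u² + (-½ ∂²/∂v² + v²)`: a free particle and an oscillator of frequency `√2`. -/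
theorem hamiltonian_modeSchwartz (f g h : 𝓢(ℝ, ℂ)) (hgh : ∀ v, h v = (v : ℂ) ^ 2 * g v) :
    hamiltonian (modeSchwartz f g) =
      (-(1 / 2) : ℝ) • modeSchwartz (SchwartzMap.derivCLM ℝ ℂ (SchwartzMap.derivCLM ℝ ℂ f)) g +
        ((-(1 / 2) : ℝ) •
          modeSchwartz f (SchwartzMap.derivCLM ℝ ℂ (SchwartzMap.derivCLM ℝ ℂ g)) +
          modeSchwartz f h) := by
  have hs : ((√2 : ℝ) : ℂ) ^ 2 = 2 := by
    rw [← Complex.ofReal_pow, Real.sq_sqrt (by norm_num)]; norm_num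
  have hs0 : ((√2 : ℝ) : ℂ) ≠ 0 := fun h => by simp [h] at hs
  ext p
  rw [hamiltonian_apply]
  simp only [lineDeriv_fst_modeSchwartz, lineDeriv_snd_modeSchwartz, LineDeriv.lineDerivOp_add,
    sub_eq_add_neg, LineDeriv.lineDerivOp_neg, LineDeriv.lineDerivOp_smul]
  simp only [smul_apply, neg_apply, add_apply,
    modeSchwartz_apply, Complex.real_smul, hgh]
  push_cast
  field_simp
  simp only [hs]
  ring

/-! ### Gaussian solutions of the Schrödinger equation -/

theorem derivCLM_polyGauss (a b : ℂ) (ha : 0 < a.re) (P : Polynomial ℂ) :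
    SchwartzMap.derivCLM ℝ ℂ (polyGauss a b ha P) = polyGauss a b ha (polyGaussDeriv a b P) := by
  ext u
  rw [SchwartzMap.derivCLM_apply]
  exact (hasDerivAt_polyGaussFun a b P u).deriv

theorem polyGaussLp_add (a b : ℂ) (P Q : Polynomial ℂ) :
    polyGaussLp a b (P + Q) = polyGaussLp a b P + polyGaussLp a b Q := by
  by_cases ha : 0 < a.re
  · apply Lp.ext
    filter_upwards [coeFn_polyGaussLp ha b (P + Q), coeFn_polyGaussLp ha b P,
      coeFn_polyGaussLp ha b Q, Lp.coeFn_add (polyGaussLp a b P) (polyGaussLp a b Q)]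
      with u h1 h2 h3 h4
    rw [h1, h4, Pi.add_apply, h2, h3]
    simp [polyGaussFun, add_mul]
  · simp [polyGaussLp, ha]

theorem polyGaussLp_C_mul (a b c : ℂ) (P : Polynomial ℂ) :
    polyGaussLp a b (Polynomial.C c * P) = c • polyGaussLp a b P := by
  by_cases ha : 0 < a.re
  · apply Lp.ext
    filter_upwards [coeFn_polyGaussLp ha b (Polynomial.C c * P), coeFn_polyGaussLp ha b P,
      Lp.coeFn_smul c (polyGaussLp a b P)] with u h1 h2 h3
    rw [h1, h3, Pi.smul_apply, h2]
    simp [polyGaussFun, mul_assoc]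
  · simp [polyGaussLp, ha]

theorem exists_antiderivative {k : ℝ → ℂ} (hk : Continuous k) :
    ∃ c : ℝ → ℂ, c 0 = 0 ∧ ∀ t, HasDerivAt c (k t) t :=
  ⟨fun t => ∫ s in (0 : ℝ)..t, k s, by simp, fun t =>
    intervalIntegral.integral_hasDerivAt_right (hk.intervalIntegrable 0 t)
      (hk.stronglyMeasurableAtFilter _ _) hk.continuousAt⟩

open Polynomial in
/-- A Gaussian wave packet of the free particle: an explicit solution of `i ∂f/∂t = -½ ∂²f/∂u²`. -/
theorem exists_free_gaussian {a₀ : ℝ} (ha₀ : 0 < a₀) (b₀ : ℂ) :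
    ∃ a b c : ℝ → ℂ, (∀ t, 0 < (a t).re) ∧ a 0 = a₀ ∧ b 0 = b₀ ∧ c 0 = 0 ∧
      ∀ t, HasDerivAt (fun s => Complex.exp (c s) • gaussLp (a s) (b s))
        (Complex.exp (c t) • (Complex.I / 2) •
          polyGaussLp (a t) (b t) (polyGaussDeriv (a t) (b t) (polyGaussDeriv (a t) (b t) 1))) t := by
  let d : ℝ → ℂ := fun t => 1 + 2 * Complex.I * a₀ * t
  have hd0 : ∀ t, d t ≠ 0 := fun t h => by
    have := congrArg Complex.re h
    simp [d] at this
  have hdd : ∀ t, HasDerivAt d (2 * Complex.I * a₀) t := fun t => by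
    have := ((hasDerivAt_id t).ofReal_comp.const_mul (2 * Complex.I * a₀)).const_add 1
    simpa [d] using this
  have hinv : ∀ t, HasDerivAt (fun s => (d s)⁻¹) (-(2 * Complex.I * a₀) / d t ^ 2) t :=
    fun t => (hdd t).inv (hd0 t)
  let a : ℝ → ℂ := fun t => a₀ * (d t)⁻¹
  let b : ℝ → ℂ := fun t => b₀ * (d t)⁻¹
  have hda : ∀ t, HasDerivAt a (-2 * Complex.I * a t ^ 2) t := fun t => by
    refine ((hinv t).const_mul (a₀ : ℂ)).congr_deriv ?_
    simp only [a]
    field_simp [hd0 t]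
  have hdb : ∀ t, HasDerivAt b (-2 * Complex.I * a t * b t) t := fun t => by
    refine ((hinv t).const_mul b₀).congr_deriv ?_
    simp only [a, b]
    field_simp [hd0 t]
  have hca : Continuous a := continuous_iff_continuousAt.2 fun t => (hda t).continuousAt
  have hcb : Continuous b := continuous_iff_continuousAt.2 fun t => (hdb t).continuousAt
  obtain ⟨c, hc0, hc⟩ := exists_antiderivative
    (k := fun t => Complex.I / 2 * (b t ^ 2 - 2 * a t)) (by fun_prop)
  have hapos : ∀ t, 0 < (a t).re := fun t => by
    have h1 : (d t).re = 1 := by simp [d]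
    have h2 : 0 < Complex.normSq (d t) := Complex.normSq_pos.2 (hd0 t)
    simp only [a]
    rw [Complex.re_ofReal_mul, Complex.inv_re, h1]
    positivity
  refine ⟨a, b, c, hapos, by simp [a, d], by simp [b, d], hc0, fun t => ?_⟩
  refine (hasDerivAt_exp_smul_gaussLp (hapos t) (hda t) (hdb t) (hc t)).congr_deriv ?_
  refine congrArg (Complex.exp (c t) • ·) ?_
  rw [← polyGaussLp_C_mul]
  congr 1
  simp only [polyGaussDeriv, derivative_one, derivative_mul, derivative_sub, derivative_C,
    derivative_X, zero_add, one_mul, zero_mul, mul_one, zero_sub]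
  have h2 : (C (Complex.I / 2) : ℂ[X]) * 2 = C Complex.I := by
    rw [show (2 : ℂ[X]) = C 2 by rfl, ← C_mul]; congr 1; ring
  simp only [map_mul, map_sub, map_neg, map_pow, show (C (2 : ℂ) : ℂ[X]) = 2 from rfl]
  linear_combination (2 * C (a t) ^ 2 * X ^ 2 - 2 * C (a t) * C (b t) * X) * (-h2)

open Polynomial in
/-- A coherent state of the oscillator of frequency `√2` stays coherent: an explicit solution of
`i ∂g/∂t = -½ ∂²g/∂v² + v² g`. -/
theorem exists_oscillator_gaussian (b₀ : ℂ) :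
    ∃ c : ℝ → ℂ, c 0 = 0 ∧ ∀ (t : ℝ) (b : ℂ), b = b₀ * Complex.exp (-(Complex.I * √2 * t)) →
      HasDerivAt (fun s : ℝ => Complex.exp (c s) •
          gaussLp ((√2 / 2 : ℝ) : ℂ) (b₀ * Complex.exp (-(Complex.I * √2 * s))))
        (Complex.exp (c t) • ((Complex.I / 2) • polyGaussLp ((√2 / 2 : ℝ) : ℂ) b
            (polyGaussDeriv ((√2 / 2 : ℝ) : ℂ) b (polyGaussDeriv ((√2 / 2 : ℝ) : ℂ) b 1)) -
          Complex.I • polyGaussLp ((√2 / 2 : ℝ) : ℂ) b (X ^ 2))) t := by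
  set a : ℂ := ((√2 / 2 : ℝ) : ℂ) with ha
  have ha2 : 2 * a ^ 2 = 1 := by
    rw [ha, ← Complex.ofReal_pow, div_pow, Real.sq_sqrt (by norm_num)]; norm_num
  have hra : (√2 : ℂ) = 2 * a := by rw [ha]; push_cast; ring
  let bt : ℝ → ℂ := fun t => b₀ * Complex.exp (-(Complex.I * √2 * t))
  have hdb : ∀ t, HasDerivAt bt (-Complex.I * (2 * a) * bt t) t := fun t => by
    have h1 : HasDerivAt (fun s : ℝ => -(Complex.I * √2 * (s : ℂ))) (-(Complex.I * √2 * 1)) t :=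
      ((hasDerivAt_id t).ofReal_comp.const_mul (Complex.I * √2)).neg
    refine (h1.cexp.const_mul b₀).congr_deriv ?_
    simp only [bt, hra]
    ring
  have hcb : Continuous bt := continuous_iff_continuousAt.2 fun t => (hdb t).continuousAt
  obtain ⟨c, hc0, hc⟩ := exists_antiderivative
    (k := fun t => Complex.I / 2 * (bt t ^ 2 - 2 * a)) (by fun_prop)
  refine ⟨c, hc0, fun t b hb => ?_⟩
  have hbt : bt t = b := hb.symm
  refine (hasDerivAt_exp_smul_gaussLp (a := fun _ => a) re_half_sqrt_two_pos
    (hasDerivAt_const t a) (hdb t) (hc t)).congr_deriv ?_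
  refine congrArg (Complex.exp (c t) • ·) ?_
  rw [hbt, sub_eq_add_neg (_ • polyGaussLp _ _ _), ← neg_smul, ← polyGaussLp_C_mul,
    ← polyGaussLp_C_mul, ← polyGaussLp_add]
  congr 1
  simp only [polyGaussDeriv, derivative_one, derivative_mul, derivative_sub, derivative_C,
    derivative_X, zero_add, one_mul, zero_mul, mul_one, zero_sub]
  have h2 : (C (Complex.I / 2) : ℂ[X]) * 2 = C Complex.I := by
    rw [show (2 : ℂ[X]) = C 2 by rfl, ← C_mul]; congr 1; ring
  have h3 : 2 * (C a : ℂ[X]) ^ 2 = 1 := by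
    rw [show (2 : ℂ[X]) = C 2 by rfl, ← C_pow, ← C_mul, ha2, C_1]
  simp only [map_mul, map_sub, map_neg, map_pow, map_zero, neg_zero,
    show (C (2 : ℂ) : ℂ[X]) = 2 from rfl]
  linear_combination (2 * C a ^ 2 * X ^ 2 - 2 * C a * C b * X) * (-h2) - C Complex.I * X ^ 2 * h3

open Polynomial in
/-- `-iH` applied to a product of Gaussians, as an element of `L²(ℝ²)`. -/
theorem toLp_hamiltonian_modeSchwartz {a a' : ℂ} (ha : 0 < a.re) (ha' : 0 < a'.re) (b b' : ℂ) :
    -Complex.I • (hamiltonian (modeSchwartz (polyGauss a b ha 1) (polyGauss a' b' ha' 1))).toLp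
        2 volume =
      mode ((Complex.I / 2) • polyGaussLp a' b' (polyGaussDeriv a' b' (polyGaussDeriv a' b' 1)) -
          Complex.I • polyGaussLp a' b' (X ^ 2)) (gaussLp a b) +
        mode (gaussLp a' b')
          ((Complex.I / 2) • polyGaussLp a b (polyGaussDeriv a b (polyGaussDeriv a b 1))) := by
  have h1 := hamiltonian_modeSchwartz (polyGauss a b ha 1) (polyGauss a' b' ha' 1)
    (polyGauss a' b' ha' (X ^ 2)) (fun v => by simp [polyGauss_apply, polyGaussFun])
  rw [h1, derivCLM_polyGauss, derivCLM_polyGauss, derivCLM_polyGauss, derivCLM_polyGauss]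
  simp only [← SchwartzMap.toLpCLM_apply (𝕜 := ℝ), map_add, map_smul]
  simp only [SchwartzMap.toLpCLM_apply, toLp_modeSchwartz, ← polyGaussLp_eq]
  simp only [map_sub, map_smul, sub_apply, smul_apply]
  have hr : ∀ y : L2R2, ((-(1 / 2) : ℝ) • y) = (-(1 / 2) : ℂ) • y := fun y => by
    rw [RCLike.real_smul_eq_coe_smul (K := ℂ)]; norm_num
  simp only [hr]
  module

/-! ### Evolution of coherent states -/

section Dynamics

variable {U : ℝ → unitary (L2R2 →L[ℂ] L2R2)}

/-- The orbit of a product of Gaussians: in the oscillator mode it keeps its form, with the parameter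
rotated; the other factor is not needed explicitly. -/
theorem schrodinger_apply_gaussian (hU : IsSchrodingerGroup U) {a₀ : ℝ} (ha₀ : 0 < a₀)
    (b₀ b₁ : ℂ) (t : ℝ) :
    ∃ f : L2R, (U t : L2R2 →L[ℂ] L2R2) (mode (gaussLp ((√2 / 2 : ℝ) : ℂ) b₁) (gaussLp a₀ b₀)) =
      mode (gaussLp ((√2 / 2 : ℝ) : ℂ) (b₁ * Complex.exp (-(Complex.I * √2 * t)))) f := by
  obtain ⟨a, b, c, ha, ha0, hb0, hc0, hf⟩ := exists_free_gaussian ha₀ b₀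
  obtain ⟨e, he0, hg⟩ := exists_oscillator_gaussian b₁
  set ω : ℂ := ((√2 / 2 : ℝ) : ℂ) with hω
  let β : ℝ → ℂ := fun s => b₁ * Complex.exp (-(Complex.I * √2 * s))
  let f : ℝ → L2R := fun s => Complex.exp (c s) • gaussLp (a s) (b s)
  let g : ℝ → L2R := fun s => Complex.exp (e s) • gaussLp ω (β s)
  let L : L2R →L[ℝ] L2R →L[ℝ] L2R2 := mode.bilinearRestrictScalars ℝ
  have hψ : ∀ s, HasDerivAt (fun s => mode (g s) (f s)) _ s := fun s =>
    (L.hasFDerivAt_of_bilinear (hg s (β s) rfl).hasFDerivAt (hf s).hasFDerivAt).hasDerivAt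
  have hUd : ∀ s, HasDerivAt (fun r => (U r : L2R2 →L[ℂ] L2R2) (mode (g s) (f s)))
      ((Complex.exp (c s) * Complex.exp (e s)) • -Complex.I • (hamiltonian
        (modeSchwartz (polyGauss (a s) (b s) (ha s) 1)
          (polyGauss ω (β s) re_half_sqrt_two_pos 1))).toLp 2 volume) 0 := fun s => by
    have h1 := (hU.hasDerivAt (modeSchwartz (polyGauss (a s) (b s) (ha s) 1)
      (polyGauss ω (β s) re_half_sqrt_two_pos 1))).const_smul
        (Complex.exp (c s) * Complex.exp (e s))
    refine h1.congr_of_eventuallyEq (Eventually.of_forall fun r => ?_)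
    simp only [Pi.smul_apply]
    rw [toLp_modeSchwartz, ← polyGaussLp_eq, ← polyGaussLp_eq, ← map_smul]
    congr 1
    simp only [f, g, map_smul, smul_apply, smul_smul]
  have key := unitaryGroup_apply_eq hU.map_add hU.continuous_apply hψ (fun s => by
    refine (hUd s).congr_deriv ?_
    rw [toLp_hamiltonian_modeSchwartz]
    have hβ : b₁ * Complex.exp (-(Complex.I * √2 * s)) = β s := rfl
    simp [L]
    simp only [hβ]
    module) t
  refine ⟨Complex.exp (e t) • f t, ?_⟩
  have h0 : mode (g 0) (f 0) = mode (gaussLp ω b₁) (gaussLp a₀ b₀) := by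
    simp [f, g, β, ha0, hb0, hc0, he0]
  rw [← h0, key]
  simp only [g, map_smul, smul_apply, β]

end Dynamics

/-! ### The generators and the graph -/

/-- Unitary conjugation moves the coherent projection `1 ⊗ |ξ_β⟩⟨ξ_β|` along the classical
trajectory `β ↦ e^{-i√2t} β`: by `schrodinger_apply_gaussian`, at the times `t` and `-t`, each of
the two projections absorbs the other. -/
theorem schrodinger_conj_ampRankOne {U : ℝ → unitary (L2R2 →L[ℂ] L2R2)}
    (hU : IsSchrodingerGroup U) (β : ℂ) (t : ℝ) :
    (U t : L2R2 →L[ℂ] L2R2) * ampRankOne mode (modeCoherent β) (modeCoherent β) *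
        star (U t : L2R2 →L[ℂ] L2R2) =
      ampRankOne mode (modeCoherent (β * Complex.exp (-(Complex.I * √2 * t))))
        (modeCoherent (β * Complex.exp (-(Complex.I * √2 * t)))) := by
  let R : ℂ → L2R2 →L[ℂ] L2R2 := fun β => ampRankOne mode (modeCoherent β) (modeCoherent β)
  have habs : ∀ (t : ℝ) (β : ℂ), R (β * Complex.exp (-(Complex.I * √2 * t))) *
      ((U t : L2R2 →L[ℂ] L2R2) * R β) = (U t : L2R2 →L[ℂ] L2R2) * R β := by
    intro t β
    set β' : ℂ := β * Complex.exp (-(Complex.I * √2 * t)) with hβ'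
    set s : ℝ := (2 : ℝ) ^ (1 / 4 : ℝ) with hs
    have hfix : R β' ∘L (U t : L2R2 →L[ℂ] L2R2) ∘L mode (modeCoherent β) =
        (U t : L2R2 →L[ℂ] L2R2) ∘L mode (modeCoherent β) := by
      refine ContinuousLinearMap.ext_on (Submodule.dense_iff_topologicalClosure_eq_top.2
        (topologicalClosure_span_gaussLp (a := ((1 : ℝ) : ℂ)) (by simp) one_ne_zero)) ?_
      rintro _ ⟨z, rfl⟩
      obtain ⟨f, hf⟩ := schrodinger_apply_gaussian hU one_pos (1 * z) ((s ^ 3 : ℝ) * β) t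
      rw [mul_assoc, ← hβ'] at hf
      have hf' : (U t : L2R2 →L[ℂ] L2R2) (mode (modeCoherent β)
          (gaussLp ((1 : ℝ) : ℂ) (1 * z))) =
          mode (modeCoherent β') ((coherentFactor β * (coherentFactor β')⁻¹) • f) := by
        simp only [modeCoherent, map_smul, smul_apply, ← hs, hf, smul_smul]
        congr 1
        field_simp [coherentFactor_ne_zero β']
      simp only [comp_apply, hf', R, ampRankOne_apply,
        isHilbertTensor_mode.adjoint_apply_apply, inner_self_eq_norm_sq_to_K, norm_modeCoherent]
      simp
    calc R β' * ((U t : L2R2 →L[ℂ] L2R2) * R β)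
        = (R β' ∘L (U t : L2R2 →L[ℂ] L2R2) ∘L mode (modeCoherent β)) ∘L
          adjoint (mode (modeCoherent β)) := rfl
      _ = _ := by rw [hfix]; rfl
  have hR : ∀ β, star (R β) = R β := fun β => star_ampRankOne mode _ _
  set β' : ℂ := β * Complex.exp (-(Complex.I * √2 * t)) with hβ'
  have hback : β' * Complex.exp (-(Complex.I * √2 * (-t : ℝ))) = β := by
    rw [hβ', mul_assoc, ← Complex.exp_add]
    push_cast
    simp
  have h1 := habs t β
  have h2 := habs (-t) β'
  rw [hback, unitaryGroup_neg hU.map_add, Unitary.coe_star] at h2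
  set u : L2R2 →L[ℂ] L2R2 := (U t : L2R2 →L[ℂ] L2R2) with hu
  have huu : u * star u = 1 := Unitary.mul_star_self_of_mem (U t).2
  have h3 : R β' * (u * R β * star u) = u * R β * star u := by
    rw [← mul_assoc, h1]
  have h4 : u * R β * star u * R β' = R β' := by
    calc u * R β * star u * R β' = u * (R β * (star u * R β')) := by simp only [mul_assoc]
      _ = R β' := by rw [h2, ← mul_assoc, huu, one_mul]
  have h5 : star (R β') = star (u * R β * star u * R β') := by rw [h4]
  rw [star_mul, star_mul, star_mul, star_star, hR, hR, ← mul_assoc u, h3] at h5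
  exact h5.symm

/-- The generators of the graph are exactly the coherent projections: the argument of `β` is
reached by time evolution and its modulus by the parameter `r`. -/
theorem generators_eq {U : ℝ → unitary (L2R2 →L[ℂ] L2R2)} (hU : IsSchrodingerGroup U) (φ : ℝ) :
    {A | ∃ (t r : ℝ) (Q : L2R2 →L[ℂ] L2R2), 0 ≤ r ∧
      IsCoherentIntegral (r * Complex.exp (Complex.I * φ)) Q ∧
      A = (U t : L2R2 →L[ℂ] L2R2) * Q * star (U t : L2R2 →L[ℂ] L2R2)} =
    Set.range fun β => ampRankOne mode (modeCoherent β) (modeCoherent β) := by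
  ext A
  constructor
  · rintro ⟨t, r, Q, -, hQ, rfl⟩
    rw [isCoherentIntegral_iff] at hQ
    rw [hQ, schrodinger_conj_ampRankOne hU]
    exact ⟨_, rfl⟩
  · rintro ⟨β, rfl⟩
    refine ⟨(φ - β.arg) / √2, ‖β‖, _, norm_nonneg _, isCoherentIntegral_iff.2 rfl, ?_⟩
    rw [schrodinger_conj_ampRankOne hU]
    have h2 : (√2 : ℂ) ≠ 0 := by
      have : √2 ≠ 0 := by positivity
      exact_mod_cast this
    have : (‖β‖ : ℂ) * Complex.exp (Complex.I * φ) *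
        Complex.exp (-(Complex.I * √2 * ((φ - β.arg) / √2 : ℝ))) = β := by
      rw [mul_assoc, ← Complex.exp_add]
      conv_rhs => rw [← Complex.norm_mul_exp_arg_mul_I β]
      congr 2
      push_cast
      field_simp
      ring
    rw [this]

/-- The closed span of the coherent projections contains all projections `1 ⊗ |g⟩⟨g|`. -/
theorem ampRankOne_mem_closedSpan (g : L2R) :
    ampRankOne mode g g ∈
      closedSpan (Set.range fun β => ampRankOne mode (modeCoherent β) (modeCoherent β)) := by
  have hc : ((((2 : ℝ) ^ (1 / 4 : ℝ)) ^ 3 : ℝ) : ℂ) ≠ 0 := by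
    have : (0 : ℝ) < ((2 : ℝ) ^ (1 / 4 : ℝ)) ^ 3 := by positivity
    exact_mod_cast this.ne'
  -- The normalization of coherent states is not holomorphic in `β`, but the Gaussians are.
  refine ampRankOne_mem_of_entire isHilbertTensor_mode _ (isClosed_closedSpan _)
    (differentiable_gaussLp re_half_sqrt_two_pos ((((2 : ℝ) ^ (1 / 4 : ℝ)) ^ 3 : ℝ) : ℂ))
    (topologicalClosure_span_gaussLp re_half_sqrt_two_pos hc) (fun z => ?_) g g
  have h1 := subset_closedSpan (Set.range fun β =>
    ampRankOne mode (modeCoherent β) (modeCoherent β)) ⟨z, rfl⟩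
  have h2 : ampRankOne mode (modeCoherent z) (modeCoherent z) =
      (coherentFactor z * starRingEnd ℂ (coherentFactor z)) •
        ampRankOne mode (gaussLp ((√2 / 2 : ℝ) : ℂ) ((((2 : ℝ) ^ (1 / 4 : ℝ)) ^ 3 : ℝ) * z))
          (gaussLp ((√2 / 2 : ℝ) : ℂ) ((((2 : ℝ) ^ (1 / 4 : ℝ)) ^ 3 : ℝ) * z)) := by
    rw [modeCoherent, ampRankOne_smul_left, ← star_ampRankOne, ampRankOne_smul_left, star_smul,
      star_ampRankOne, smul_smul]
    rfl
  simp only [SetLike.mem_coe, h2] at h1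
  exact (Submodule.smul_mem_iff _ (mul_ne_zero (coherentFactor_ne_zero z)
    ((map_ne_zero _).2 (coherentFactor_ne_zero z)))).1 h1

end OscillatorGraph

end

theorem theorem2 (U : ℝ → unitary (OscillatorGraph.L2R2 →L[ℂ] OscillatorGraph.L2R2))
    (hU : OscillatorGraph.IsSchrodingerGroup U) (φ : ℝ)
    (g₀ : OscillatorGraph.L2R) (hg₀ : ‖g₀‖ = 1)
    (φs : HilbertBasis ℕ ℂ OscillatorGraph.L2R) :
    OscillatorGraph.IsNoncommutativeGraph (OscillatorGraph.oscillatorGraph U φ) ∧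
    Orthonormal ℂ (fun k => OscillatorGraph.modeProduct (φs k) g₀) ∧
    ∃ P : OscillatorGraph.L2R2 →L[ℂ] OscillatorGraph.L2R2,
      (∀ f : OscillatorGraph.L2R2,
        HasSum (fun k => ⟪OscillatorGraph.modeProduct (φs k) g₀, f⟫_ℂ •
          OscillatorGraph.modeProduct (φs k) g₀) (P f)) ∧
      Cardinal.aleph0 ≤ LinearMap.rank (P : OscillatorGraph.L2R2 →ₗ[ℂ] OscillatorGraph.L2R2) ∧
      OscillatorGraph.IsMaximalQuantumAnticlique (OscillatorGraph.oscillatorGraph U φ) P := by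
  have hV : OscillatorGraph.oscillatorGraph U φ =
      OscillatorGraph.closedSpan (Set.range fun β => OscillatorGraph.ampRankOne
        OscillatorGraph.mode (OscillatorGraph.modeCoherent β)
          (OscillatorGraph.modeCoherent β)) := by
    rw [OscillatorGraph.oscillatorGraph, OscillatorGraph.generators_eq hU]
  rw [hV]
  obtain ⟨h1, h2, h3, h4, h5⟩ := OscillatorGraph.isMaximalQuantumAnticlique_ampRankOne
    OscillatorGraph.isHilbertTensor_mode
    (by rintro A ⟨β, rfl⟩; exact ⟨_, rfl⟩)
    OscillatorGraph.ampRankOne_mem_closedSpan φs φs hg₀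
  exact ⟨h1, h2, _, h3, h4, h5⟩
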